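/- Let $k$ be a field, $\mathcal C$ a $k$-linear abelian category, and $\mathcal E=(E_i)_{i\in\mathbb Z}$ a sequence of objects of $\mathcal C$ such that $\dim_k\operatorname{Hom}(E_i,X)<\infty$ for all $i\in\mathbb Z$ and $X\in\mathcal C$. Assume that $\mathcal E$ is coherent, that is: (a) ($\mathcal E$ is projective) for every epimorphism $X\to Y$ in $\mathcal C$ there is $n\in\mathbb Z$ such that $\operatorname{Hom}(E_i,X)\to\operatorname{Hom}(E_i,Y)$ is surjective for all $i<n$; (b) for every $X\in\mathcal C$ and $m\in\mathbb Z$ there are finitely many integers $i_1,\dots,i_s\le m$ such that the canonical map $\bigoplus_{j=1}^s\operatorname{Hom}(E_{i_j},X)\otimes_k\operatorname{Hom}(E_i,E_{i_j})\to\operatorname{Hom}(E_i,X)$ is surjective for all $i\ll 0$. Let $A=A(\mathcal E)=\bigoplus_{i\le j}A_{ij}$ be the associated $\mathbb Z$-algebra: $A_{ij}=\operatorname{Hom}(E_i,E_j)$ for $i<j$, $A_{ii}=k$, with multiplication $A_{jl}\otimes A_{ij}\to A_{il}$ induced by composition. Graded right $A$-modules $M=\bigoplus_i M_i$ have actions $M_j\otimes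 A_{ij}\to M_i$; put $P_j=\bigoplus_i A_{ij}$, and let $S_j$ be the module which is $k$ in degree $j$ and $0$ in the other degrees. A module $M$ is finitely generated if it is a quotient of a finite direct sum of modules $P_j$; it is coherent if it is finitely generated and the kernel of every homomorphism $P\to M$ with $P$ a finite direct sum of modules $P_j$ is finitely generated. Let $\operatorname{coh}A$ be the abelian category of coherent modules and $\operatorname{coh}^bA\subset\operatorname{coh}A$ the Serre subcategory of bounded modules ($M_i\ne0$ for only finitely many $i$). Let $\mathcal C_0\subset\mathcal C$ be the Serre subcategory of the objects $X$ with $\operatorname{Hom}(E_i,X)=0$ for all $i\ll0$. Then $A$ is coherent (all modules $P_j$ and $S_j$ are coherent), and there is a $k$-linear equivalence of categories $$\mathcal C/\mathcal C_0\simeq\operatorname{cohproj}A:=\operatorname{coh}A/\operatorname{coh}^bA .$$ In particular, if $\mathcal E$ is ample, i.e. if moreover $\mathcal C_0=0$, then there is a $k$-linear equivalence $\mathcal C\simeq\operatorname{cohproj}A$. -/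

import Mathlib

open CategoryTheory CategoryTheory.Limits Opposite
open scoped TensorProduct DirectSum

universe v u

noncomputable section

namespace NCProj

/-! ### Coherent objects relative to a family of projective objects -/

section Abstract

variable {D : Type u} [Category.{v} D] [Abelian D] (Q : ObjectProperty D)

/-- `M` is finitely generated with respect to the family `Q`: it is a quotient of an object
of `Q`. -/
def IsFG : ObjectProperty D := fun M => ∃ (P : D) (_ : Q P) (p : P ⟶ M), Epi p

/-- `M` is coherent with respect to the family `Q`: it is finitely generated, and so is the kernel
of every morphism `P ⟶ M` with `P` in `Q`. -/
def IsCoh : ObjectProperty D := fun M =>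
  IsFG Q M ∧ ∀ (P : D) (_ : Q P) (f : P ⟶ M), IsFG Q (kernel f)

variable {Q}

theorem IsFG.of_epi {D : Type u} [Category.{v} D] {Q : ObjectProperty D} {M N : D} (f : M ⟶ N) [Epi f] (h : IsFG Q M) : IsFG Q N := by
  obtain ⟨P, hP, p, _⟩ := h
  exact ⟨P, hP, p ≫ f, epi_comp _ _⟩

theorem IsCoh.of_mono {M N : D} (f : M ⟶ N) [Mono f] (hM : IsFG Q M) (hN : IsCoh Q N) :
    IsCoh Q M := by
  refine ⟨hM, fun P hP g => ?_⟩
  exact (hN.2 P hP (g ≫ f)).of_epi (kernelCompMono g f).hom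

/-- If a finitely generated `K` maps onto the kernel of `f`, then that kernel is finitely
generated. -/
theorem isFG_kernel_of_lift {K M N : D} (f : M ⟶ N) (r : K ⟶ M) (hr : r ≫ f = 0)
    (hK : IsFG Q K)
    (H : ∀ ⦃A : D⦄ (a : A ⟶ M), a ≫ f = 0 →
      ∃ (A' : D) (π : A' ⟶ A) (_ : Epi π) (b : A' ⟶ K), π ≫ a = b ≫ r) :
    IsFG Q (kernel f) := by
  have : Epi (kernel.lift f r hr) := by
    rw [epi_iff_surjective_up_to_refinements]
    intro A a
    obtain ⟨A', π, hπ, b, hb⟩ := H (a ≫ kernel.ι f) (by simp)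
    exact ⟨A', π, hπ, b, by
      rw [← cancel_mono (kernel.ι f)]; simpa using hb⟩
  exact hK.of_epi (kernel.lift f r hr)

theorem IsCoh.kernel {M N : D} (hM : IsCoh Q M) (hN : IsCoh Q N) (f : M ⟶ N) :
    IsCoh Q (kernel f) := by
  obtain ⟨P, hP, p, _⟩ := hM.1
  refine IsCoh.of_mono (kernel.ι f) ?_ hM
  refine isFG_kernel_of_lift f (kernel.ι (p ≫ f) ≫ p) (by simp) (hN.2 P hP (p ≫ f)) ?_
  intro A a ha
  obtain ⟨A', π, hπ, b, hb⟩ := surjective_up_to_refinements_of_epi p a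
  exact ⟨A', π, hπ, kernel.lift _ b (by rw [← Category.assoc, ← hb]; simp [ha]), by simp [hb]⟩

variable (Q) in
/-- The hypotheses on a family `Q` under which coherent objects form an abelian subcategory. -/
structure IsProjFamily : Prop where
  projective : ∀ P, Q P → Projective P
  zero : ∀ Z : D, IsZero Z → Q Z
  biprod : ∀ P P', Q P → Q P' → Q (P ⊞ P')

theorem IsCoh.cokernel (hQ : IsProjFamily Q) {M N : D} (hM : IsCoh Q M) (hN : IsCoh Q N)
    (f : M ⟶ N) : IsCoh Q (cokernel f) := by
  refine ⟨hN.1.of_epi (cokernel.π f), fun P hP g => ?_⟩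
  have := hQ.projective P hP
  obtain ⟨R, hR, r, _⟩ := hM.1
  let g' : P ⟶ N := Projective.factorThru g (cokernel.π f)
  have hg' : g' ≫ cokernel.π f = g := Projective.factorThru_comp _ _
  let s : P ⊞ R ⟶ N := biprod.desc g' (r ≫ f)
  have key : (kernel.ι s ≫ biprod.fst) ≫ g' + (kernel.ι s ≫ biprod.snd) ≫ r ≫ f = 0 := by
    have h2 : ∀ {W : D} (t : W ⟶ P ⊞ R),
        (t ≫ biprod.fst) ≫ g' + (t ≫ biprod.snd) ≫ r ≫ f = t ≫ s := by
      intro W t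
      simp [s, biprod.desc_eq]
    rw [h2, kernel.condition]
  refine isFG_kernel_of_lift g (kernel.ι s ≫ biprod.fst) ?_
    (hN.2 _ (hQ.biprod P R hP hR) s) ?_
  · rw [← hg', ← Category.assoc, eq_neg_of_add_eq_zero_left key]
    simp
  · intro A a ha
    have hex : (ShortComplex.mk f (cokernel.π f) (cokernel.condition f)).Exact :=
      ShortComplex.exact_cokernel f
    obtain ⟨A₁, π₁, hπ₁, x, hx⟩ := hex.exact_up_to_refinements (a ≫ g')
      (by simp [hg', ha])
    obtain ⟨A₂, π₂, hπ₂, y, hy⟩ := surjective_up_to_refinements_of_epi r x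
    have hx' : π₁ ≫ a ≫ g' = x ≫ f := hx
    have h3 : biprod.lift (π₂ ≫ π₁ ≫ a) (-y) ≫ s = 0 := by
      simp only [s, biprod.lift_desc, Category.assoc, Preadditive.neg_comp]
      rw [hx', reassoc_of% hy]
      simp
    exact ⟨A₂, π₂ ≫ π₁, epi_comp _ _, kernel.lift s _ h3, by simp⟩

theorem IsCoh.biprod (hQ : IsProjFamily Q) {M N : D} (hM : IsCoh Q M) (hN : IsCoh Q N) :
    IsCoh Q (M ⊞ N) := by
  constructor
  · obtain ⟨P, hP, p, _⟩ := hM.1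
    obtain ⟨R, hR, r, _⟩ := hN.1
    exact ⟨P ⊞ R, hQ.biprod P R hP hR, biprod.map p r, inferInstance⟩
  · intro P hP f
    obtain ⟨R, hR, r, _⟩ := hM.2 P hP (f ≫ biprod.fst)
    let s : R ⟶ N := r ≫ kernel.ι (f ≫ biprod.fst) ≫ f ≫ biprod.snd
    refine isFG_kernel_of_lift f (kernel.ι s ≫ r ≫ kernel.ι (f ≫ biprod.fst)) ?_
      (hN.2 R hR s) ?_
    · apply biprod.hom_ext
      · simp
      · simp [s]
    · intro A a ha
      obtain ⟨A₁, π₁, hπ₁, x, hx⟩ := surjective_up_to_refinements_of_epi r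
        (kernel.lift (f ≫ biprod.fst) a (by simp [reassoc_of% ha]))
      have hx' : π₁ ≫ a = x ≫ r ≫ kernel.ι (f ≫ biprod.fst) := by
        have := congrArg (· ≫ kernel.ι (f ≫ biprod.fst)) hx
        simpa using this
      have h3 : x ≫ s = 0 := by
        simp only [s]
        rw [← reassoc_of% hx', reassoc_of% ha]
        simp
      exact ⟨A₁, π₁, hπ₁, kernel.lift s x h3, by simp [hx']⟩

theorem IsCoh.of_iso {M N : D} (e : M ≅ N) (hM : IsCoh Q M) : IsCoh Q N :=
  IsCoh.of_mono e.inv (hM.1.of_epi e.hom) hM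

theorem IsCoh.of_isZero (hQ : IsProjFamily Q) {Z : D} (hZ : IsZero Z) : IsCoh Q Z := by
  refine ⟨⟨Z, hQ.zero Z hZ, 𝟙 Z, inferInstance⟩, fun P hP f => ?_⟩
  have hf : f = 0 := hZ.eq_of_tgt _ _
  subst hf
  exact ⟨P, hP, kernelZeroIsoSource.inv, inferInstance⟩

theorem isCoh_containsZero (hQ : IsProjFamily Q) : (IsCoh Q).ContainsZero :=
  ⟨⟨_, isZero_zero D, IsCoh.of_isZero hQ (isZero_zero D)⟩⟩

theorem isCoh_closedUnderIso : (IsCoh Q).IsClosedUnderIsomorphisms := ⟨fun e h => h.of_iso e⟩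

theorem isCoh_closedUnderKernels : (IsCoh Q).IsClosedUnderKernels := by
  constructor
  rintro _ ⟨f, c, hc, h⟩
  exact (IsCoh.kernel h.1 h.2 f).of_iso ((kernelIsKernel f).conePointUniqueUpToIso hc)

theorem isCoh_closedUnderCokernels (hQ : IsProjFamily Q) : (IsCoh Q).IsClosedUnderCokernels := by
  constructor
  rintro _ ⟨f, c, hc, h⟩
  exact (IsCoh.cokernel hQ h.1 h.2 f).of_iso
    ((cokernelIsCokernel f).coconePointUniqueUpToIso hc)

/-- A property containing zero and closed under isomorphisms and biproducts is closed under finite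
products. -/
theorem closedUnderFiniteProducts_of_biprod (P : ObjectProperty D) [P.ContainsZero]
    [P.IsClosedUnderIsomorphisms] (h : ∀ M N : D, P M → P N → P (M ⊞ N)) :
    P.IsClosedUnderFiniteProducts := by
  have : P.IsClosedUnderBinaryProducts := by
    constructor
    rintro X ⟨p⟩
    let e : p.diag ≅ pair (p.diag.obj ⟨.left⟩) (p.diag.obj ⟨.right⟩) := diagramIsoPair _
    let hl := (IsLimit.postcomposeHomEquiv e _).symm p.isLimit
    let i := (BinaryBiproduct.isLimit (p.diag.obj ⟨.left⟩)
      (p.diag.obj ⟨.right⟩)).conePointUniqueUpToIso hl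
    exact P.prop_of_iso i (h _ _ (p.prop_diag_obj _) (p.prop_diag_obj _))
  exact ObjectProperty.IsClosedUnderFiniteProducts.mk'

theorem isCoh_closedUnderFiniteProducts (hQ : IsProjFamily Q) :
    (IsCoh Q).IsClosedUnderFiniteProducts :=
  have := isCoh_containsZero hQ
  have := isCoh_closedUnderIso (Q := Q)
  closedUnderFiniteProducts_of_biprod _ fun _ _ hM hN => hM.biprod hQ hN

theorem preservesFiniteLimits_ι (P : ObjectProperty D) [P.ContainsZero] [P.IsClosedUnderKernels]
    [P.IsClosedUnderCokernels] [P.IsClosedUnderFiniteProducts] : PreservesFiniteLimits P.ι := by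
  rw [((Functor.preservesFiniteLimits_tfae P.ι).out 3 2 :)]
  intro _ _ f
  exact P.preservesKernels_ι f

theorem preservesFiniteColimits_ι (P : ObjectProperty D) [P.ContainsZero]
    [P.IsClosedUnderKernels] [P.IsClosedUnderCokernels] [P.IsClosedUnderFiniteProducts] :
    PreservesFiniteColimits P.ι := by
  rw [((Functor.preservesFiniteColimits_tfae P.ι).out 3 2 :)]
  intro _ _ f
  exact P.preservesCokernels_ι f

/-- The direct sum over a disjoint union of index sets. -/
def biproductSumIso [HasFiniteBiproducts D] {ι ι' : Type} [Finite ι] [Finite ι']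
    (F : ι ⊕ ι' → D) :
    (⨁ fun a => F (Sum.inl a)) ⊞ (⨁ fun a => F (Sum.inr a)) ≅ ⨁ F where
  hom := biprod.desc (biproduct.desc fun a => biproduct.ι F (Sum.inl a))
    (biproduct.desc fun a => biproduct.ι F (Sum.inr a))
  inv := biproduct.desc fun
    | Sum.inl a => biproduct.ι (fun a => F (Sum.inl a)) a ≫ biprod.inl
    | Sum.inr a => biproduct.ι (fun a => F (Sum.inr a)) a ≫ biprod.inr
  hom_inv_id := by
    apply biprod.hom_ext'
    · apply biproduct.hom_ext'
      intro b
      rw [biprod.inl_desc_assoc, biproduct.ι_desc_assoc, biproduct.ι_desc, Category.comp_id]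
    · apply biproduct.hom_ext'
      intro b
      rw [biprod.inr_desc_assoc, biproduct.ι_desc_assoc, biproduct.ι_desc, Category.comp_id]
  inv_hom_id := by
    apply biproduct.hom_ext'
    rintro (b | b)
    · simp only [biproduct.ι_desc_assoc, Category.assoc, biprod.inl_desc, biproduct.ι_desc,
        Category.comp_id]
    · simp only [biproduct.ι_desc_assoc, Category.assoc, biprod.inr_desc, biproduct.ι_desc,
        Category.comp_id]

end Abstract

/-! ### Algebras graded by pairs of integers -/

/-- A `ℤ`-algebra over the field `k`: an associative algebra `A = ⨁_{i ≤ j} A i j` with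
`A i i = k · 1 ≅ k`, with multiplication `A j l ⊗ A i j → A i l`, and with finite-dimensional
components. -/
structure ZAlgebra (k : Type v) [Field k] where
  /-- the component `A i j` -/
  comp : ℤ → ℤ → Type v
  [addCommGroup : ∀ i j, AddCommGroup (comp i j)]
  [module : ∀ i j, Module k (comp i j)]
  comp_eq_zero : ∀ {i j : ℤ}, j < i → ∀ a : comp i j, a = 0
  /-- the unit of the component `A i i` -/
  one : ∀ i, comp i i
  smul_one_bijective : ∀ i, Function.Bijective (fun c : k => c • one i)
  /-- the multiplication `A j l ⊗ A i j → A i l` -/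
  mul : ∀ {i j l : ℤ}, comp j l →ₗ[k] comp i j →ₗ[k] comp i l
  one_mul : ∀ {i j : ℤ} (a : comp i j), mul (one j) a = a
  mul_one : ∀ {i j : ℤ} (a : comp i j), mul a (one i) = a
  mul_assoc : ∀ {i j l m : ℤ} (a : comp l m) (b : comp j l) (c : comp i j),
    mul (mul a b) c = mul a (mul b c)
  finite : ∀ i j, Module.Finite k (comp i j)

attribute [instance] ZAlgebra.addCommGroup ZAlgebra.module ZAlgebra.finite

namespace ZAlgebra

variable {k : Type v} [Field k]

/-- The objects of the `k`-linear category attached to `A`: one for every integer. -/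
@[ext]
structure Idx (A : ZAlgebra.{v} k) where
  /-- the integer -/
  deg : ℤ

variable (A : ZAlgebra.{v} k)

/-- The category attached to `A`: morphisms `i ⟶ j` are the elements of `A i j`. -/
instance : Category.{v} A.Idx where
  Hom i j := A.comp i.deg j.deg
  id i := A.one i.deg
  comp f g := A.mul g f
  id_comp f := A.mul_one f
  comp_id f := A.one_mul f
  assoc f g h := (A.mul_assoc h g f).symm

instance : Preadditive A.Idx where
  homGroup i j := inferInstanceAs (AddCommGroup (A.comp i.deg j.deg))
  add_comp i j l (f f' : A.comp i.deg j.deg) g := map_add (A.mul (i := i.deg) (j := j.deg) (l := l.deg) g) f f'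
  comp_add i j l f (g g' : A.comp j.deg l.deg) :=
    LinearMap.map_add₂ (A.mul (i := i.deg) (j := j.deg) (l := l.deg)) g g' f

instance : Linear k A.Idx where
  homModule i j := inferInstanceAs (Module k (A.comp i.deg j.deg))
  smul_comp i j l r (f : A.comp i.deg j.deg) g := map_smul (A.mul (i := i.deg) (j := j.deg) (l := l.deg) g) r f
  comp_smul i j l f r (g : A.comp j.deg l.deg) :=
    LinearMap.map_smul₂ (A.mul (i := i.deg) (j := j.deg) (l := l.deg)) r g f

/-- A graded right `A`-module `M = ⨁ M i`, with action `M j ⊗ A i j → M i` such that the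
units act as the identity, is a `k`-linear contravariant functor on the category attached to `A`,
with values in `k`-vector spaces. -/
def isRightModule : ObjectProperty (A.Idxᵒᵖ ⥤ ModuleCat.{v} k) :=
  fun M => M.Additive ∧ ∀ ⦃i j : A.Idx⦄ (a : i ⟶ j) (c : k), M.map (c • a).op = c • M.map a.op

theorem isRightModule_of_mono {M N : A.Idxᵒᵖ ⥤ ModuleCat.{v} k} (f : M ⟶ N) [Mono f]
    (hN : A.isRightModule N) : A.isRightModule M := by
  have := hN.1
  refine ⟨⟨fun {X Y a b} => ?_⟩, fun i j a c => ?_⟩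
  · rw [← cancel_mono (f.app Y)]
    simp [Functor.map_add]
  · rw [← cancel_mono (f.app (op i))]
    simp [hN.2 a c]

theorem isRightModule_of_epi {M N : A.Idxᵒᵖ ⥤ ModuleCat.{v} k} (f : M ⟶ N) [Epi f]
    (hM : A.isRightModule M) : A.isRightModule N := by
  have := hM.1
  refine ⟨⟨fun {X Y a b} => ?_⟩, fun i j a c => ?_⟩
  · rw [← cancel_epi (f.app X)]
    simp [← NatTrans.naturality, Functor.map_add]
  · rw [← cancel_epi (f.app (op j))]
    simp [← NatTrans.naturality, hM.2 a c]

instance : (A.isRightModule).IsClosedUnderSubobjects :=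
  ⟨fun f _ h => A.isRightModule_of_mono f h⟩

instance : (A.isRightModule).IsClosedUnderQuotients :=
  ⟨fun f _ h => A.isRightModule_of_epi f h⟩

instance : (A.isRightModule).ContainsZero :=
  ⟨⟨_, isZero_zero _,
    ⟨fun {X _ _ _} => ((isZero_zero (A.Idxᵒᵖ ⥤ ModuleCat.{v} k)).obj X).eq_of_src _ _⟩,
    fun _ _ _ _ => ((isZero_zero (A.Idxᵒᵖ ⥤ ModuleCat.{v} k)).obj _).eq_of_src _ _⟩⟩

instance : (A.isRightModule).IsClosedUnderFiniteProducts := by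
  refine closedUnderFiniteProducts_of_biprod _ fun M N hM hN => ?_
  have := hM.1
  have := hN.1
  have ext' : ∀ {X : ModuleCat.{v} k} {Y : A.Idxᵒᵖ} (f g : X ⟶ (M ⊞ N).obj Y),
      f ≫ (biprod.fst : M ⊞ N ⟶ M).app Y = g ≫ (biprod.fst : M ⊞ N ⟶ M).app Y →
      f ≫ (biprod.snd : M ⊞ N ⟶ N).app Y = g ≫ (biprod.snd : M ⊞ N ⟶ N).app Y → f = g := by
    intro X Y f g h₁ h₂
    have h : (biprod.fst : M ⊞ N ⟶ M).app Y ≫ (biprod.inl : M ⟶ M ⊞ N).app Y +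
        (biprod.snd : M ⊞ N ⟶ N).app Y ≫ (biprod.inr : N ⟶ M ⊞ N).app Y = 𝟙 _ :=
      congrArg (fun t => NatTrans.app t Y) (biprod.total (X := M) (Y := N))
    rw [← Category.comp_id f, ← Category.comp_id g, ← h]
    simp only [Preadditive.comp_add, reassoc_of% h₁, reassoc_of% h₂]
  refine ⟨⟨fun {X Y a b} => ?_⟩, fun i j a c => ?_⟩
  · apply ext' <;> simp [Functor.map_add]
  · apply ext' <;> simp [hM.2 a c, hN.2 a c]

/-- The category `GR A` of graded right `A`-modules. -/
abbrev GrMod := A.isRightModule.FullSubcategory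

instance : HasFiniteBiproducts A.GrMod := Abelian.hasFiniteBiproducts

variable {A}

/-- The graded component `M i` of a graded right `A`-module. -/
abbrev GrMod.component (M : A.GrMod) (i : ℤ) : ModuleCat.{v} k := M.obj.obj (op ⟨i⟩)

/-- The action `M j ⊗ A i j → M i`, written as `x ↦ x · a`. -/
abbrev GrMod.act (M : A.GrMod) {i j : ℤ} (a : A.comp i j) : M.component j ⟶ M.component i :=
  M.obj.map (X := op (⟨j⟩ : A.Idx)) (Y := op (⟨i⟩ : A.Idx)) (Quiver.Hom.op a)

variable (A)

/-- The module `P j = ⨁ i, A i j`. -/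
def proj (j : ℤ) : A.GrMod :=
  ⟨(linearYoneda k A.Idx).obj ⟨j⟩, ⟨inferInstance, fun X Y f r => by
    ext g
    exact Linear.smul_comp _ _ _ r f g⟩⟩

/-- The family of finite direct sums of the modules `P j`. -/
def isFreeFG : ObjectProperty A.GrMod :=
  fun P => ∃ (ι : Type) (_ : Finite ι) (j : ι → ℤ), Nonempty (P ≅ ⨁ fun a => A.proj (j a))

theorem epi_app {M N : A.GrMod} (f : M ⟶ N) [Epi f] (i : A.Idxᵒᵖ) : Epi (f.hom.app i) := by
  have := A.isRightModule.preservesEpimorphisms_ι_of_isNormalMonoCategory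
  have : Epi f.hom := inferInstanceAs (Epi (A.isRightModule.ι.map f))
  infer_instance

theorem mono_app {M N : A.GrMod} (f : M ⟶ N) [Mono f] (i : A.Idxᵒᵖ) : Mono (f.hom.app i) := by
  have := A.isRightModule.preservesMonomorphisms_ι_of_isNormalEpiCategory
  have : Mono f.hom := inferInstanceAs (Mono (A.isRightModule.ι.map f))
  infer_instance

theorem projective_proj (j : ℤ) : Projective (A.proj j) := by
  constructor
  intro M N f e _
  have hsurj : Function.Surjective (e.hom.app (op ⟨j⟩)) :=
    (ModuleCat.epi_iff_surjective _).1 (A.epi_app e _)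
  obtain ⟨x, hx⟩ := hsurj (f.hom.app (op ⟨j⟩) (𝟙 (⟨j⟩ : A.Idx)))
  have := M.property.1
  let g : A.proj j ⟶ M := ObjectProperty.homMk
    { app := fun i => ModuleCat.ofHom
        { toFun := fun a => M.obj.map (Quiver.Hom.op (X := i.unop) (Y := (⟨j⟩ : A.Idx)) a) x
          map_add' := fun a b => by
            have := congrArg (fun t => t.hom x) (M.obj.map_add
              (f := Quiver.Hom.op (X := i.unop) (Y := (⟨j⟩ : A.Idx)) a)
              (g := Quiver.Hom.op (X := i.unop) (Y := (⟨j⟩ : A.Idx)) b))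
            exact this
          map_smul' := fun r a => by
            exact congrArg (fun t => t.hom x)
              (M.property.2 (i := i.unop) (j := (⟨j⟩ : A.Idx)) a r) }
      naturality := fun i i' b => by
        ext a
        exact congrArg (fun t => t.hom x) (M.obj.map_comp
          (Quiver.Hom.op (X := i.unop) (Y := (⟨j⟩ : A.Idx)) a) b) }
  refine ⟨g, ?_⟩
  ext i a
  have h1 := congrArg (fun t => t.hom x)
    (e.hom.naturality (Quiver.Hom.op (X := i.unop) (Y := (⟨j⟩ : A.Idx)) a))
  have h2 := congrArg (fun t => t.hom (𝟙 (⟨j⟩ : A.Idx)))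
    (f.hom.naturality (Quiver.Hom.op (X := i.unop) (Y := (⟨j⟩ : A.Idx)) a))
  have h3 : ((A.proj j).obj.map (Quiver.Hom.op (X := i.unop) (Y := (⟨j⟩ : A.Idx)) a)).hom
      (𝟙 (⟨j⟩ : A.Idx)) = a := Category.comp_id (X := i.unop) (Y := (⟨j⟩ : A.Idx)) a
  have h4 := congrArg (N.obj.map (Quiver.Hom.op (X := i.unop) (Y := (⟨j⟩ : A.Idx)) a)).hom hx
  have h5 := congrArg (f.hom.app i).hom h3
  exact h1.trans (h4.trans (h2.symm.trans h5))

theorem isProjFamily : IsProjFamily A.isFreeFG where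
  projective := by
    rintro P ⟨ι, _, j, ⟨e⟩⟩
    have : ∀ a, Projective (A.proj (j a)) := fun a => A.projective_proj (j a)
    exact Projective.of_iso e.symm ⟨fun f g _ =>
      ⟨biproduct.desc fun b =>
        Projective.factorThru (biproduct.ι (fun a => A.proj (j a)) b ≫ f) g, by
          apply biproduct.hom_ext'
          intro b
          rw [biproduct.ι_desc_assoc, Projective.factorThru_comp]⟩⟩
  zero := by
    intro Z hZ
    refine ⟨PEmpty, inferInstance, PEmpty.elim, ⟨hZ.iso ?_⟩⟩
    rw [IsZero.iff_id_eq_zero]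
    exact biproduct.hom_ext _ _ fun a => PEmpty.elim a
  biprod := by
    rintro P P' ⟨ι, _, j, ⟨e⟩⟩ ⟨ι', _, j', ⟨e'⟩⟩
    exact ⟨ι ⊕ ι', inferInstance, Sum.elim j j', ⟨biprod.mapIso e e' ≪≫
      biproductSumIso fun a => A.proj (Sum.elim j j' a)⟩⟩

/-! ### The simple modules -/

/-- The identification of `k` with the component `A i i`. -/
def unitEquiv (i : ℤ) : k ≃ₗ[k] A.comp i i :=
  LinearEquiv.ofBijective (LinearMap.toSpanSingleton k _ (A.one i)) (A.smul_one_bijective i)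

/-- The augmentation: the identification `A i i = k` in the components `A i i`, and zero in the other
components. -/
def aug (i j : ℤ) : A.comp i j →ₗ[k] k :=
  if h : i = j then by subst h; exact (A.unitEquiv i).symm.toLinearMap else 0

theorem unitEquiv_apply (i : ℤ) (c : k) : A.unitEquiv i c = c • A.one i := rfl

theorem aug_self (i : ℤ) (a : A.comp i i) : A.aug i i a = (A.unitEquiv i).symm a := by
  simp [aug]

theorem aug_one (i : ℤ) : A.aug i i (A.one i) = 1 := by
  rw [aug_self, LinearEquiv.symm_apply_eq]
  simp [unitEquiv_apply]

theorem aug_of_ne {i j : ℤ} (h : i ≠ j) (a : A.comp i j) : A.aug i j a = 0 := by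
  simp [aug, h]

theorem aug_mul {i j l : ℤ} (a : A.comp j l) (b : A.comp i j) :
    A.aug i l (A.mul a b) = A.aug j l a * A.aug i j b := by
  by_cases hij : i = j
  · subst hij
    by_cases hil : i = l
    · subst hil
      obtain ⟨c, rfl⟩ := (A.unitEquiv i).surjective a
      have h : A.mul (A.unitEquiv i c) b = c • b := by
        simp [unitEquiv_apply, A.one_mul]
      simp [h, aug_self]
    · simp [A.aug_of_ne hil]
  · rw [A.aug_of_ne hij, mul_zero]
    by_cases hil : i = l
    · subst hil
      rcases lt_or_gt_of_ne hij with h | h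
      · rw [A.comp_eq_zero h a]
        simp
      · rw [A.comp_eq_zero h b]
        simp
    · exact A.aug_of_ne hil _

/-- The component of degree `i` of the module `S j`: it is `k` if `i = j`, and `0` otherwise. -/
def simpleComponent (j i : ℤ) : Submodule k k where
  carrier := {c | i ≠ j → c = 0}
  add_mem' ha hb h := by simp [ha h, hb h]
  zero_mem' _ := rfl
  smul_mem' c x hx h := by simp [hx h]

/-- The simple module `S j`, which is `k` in degree `j` and zero in the other degrees. -/
def simple (j : ℤ) : A.GrMod :=
  ⟨{ obj := fun i => ModuleCat.of k (simpleComponent (k := k) j i.unop.deg)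
     map := fun {i i'} f => ModuleCat.ofHom
      { toFun := fun c => ⟨A.aug i'.unop.deg i.unop.deg f.unop * c.1, fun h => by
          by_cases h' : i'.unop.deg = i.unop.deg
          · rw [c.2 (h' ▸ h), mul_zero]
          · rw [A.aug_of_ne h', zero_mul]⟩
        map_add' := fun c d => Subtype.ext (mul_add _ _ _)
        map_smul' := fun r c => Subtype.ext (mul_left_comm _ _ _) }
     map_id := fun i => by
      ext c
      change A.aug _ _ (A.one i.unop.deg) * c.1 = c.1
      rw [A.aug_one, _root_.one_mul]
     map_comp := fun {i i' i''} f g => by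
      ext c
      change A.aug _ _ (A.mul f.unop g.unop) * c.1 = A.aug _ _ g.unop * (A.aug _ _ f.unop * c.1)
      rw [A.aug_mul]
      ring },
   ⟨⟨fun {X Y f g} => by
      ext c
      have h := map_add (A.aug Y.unop.deg X.unop.deg) f.unop g.unop
      exact (congrArg (· * c.1) h).trans (add_mul _ _ _)⟩,
    fun i i' a r => by
      ext c
      have h := map_smul (A.aug i.deg i'.deg) r a
      exact (congrArg (· * c.1) h).trans (smul_mul_assoc _ _ _)⟩⟩

/-! ### Coherent modules -/

/-- The property of being a coherent graded right `A`-module. -/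
def isCoherentModule : ObjectProperty A.GrMod := IsCoh A.isFreeFG

/-- `A` is weakly (right) coherent if all modules `P j` are coherent. -/
def IsWeaklyCoherent : Prop := ∀ j, A.isCoherentModule (A.proj j)

/-- `A` is (right) coherent if all modules `P j` and all modules `S j` are coherent. -/
def IsCoherent : Prop := A.IsWeaklyCoherent ∧ ∀ j, A.isCoherentModule (A.simple j)

instance : (A.isCoherentModule).ContainsZero := isCoh_containsZero A.isProjFamily

instance : (A.isCoherentModule).IsClosedUnderKernels := isCoh_closedUnderKernels

instance : (A.isCoherentModule).IsClosedUnderCokernels :=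
  isCoh_closedUnderCokernels A.isProjFamily

instance : (A.isCoherentModule).IsClosedUnderFiniteProducts :=
  isCoh_closedUnderFiniteProducts A.isProjFamily

/-- The abelian category `coh A` of coherent graded right `A`-modules. -/
abbrev Coh := A.isCoherentModule.FullSubcategory

/-- `M` is bounded if `M i` is nonzero for only finitely many `i`. -/
def isBounded : ObjectProperty A.GrMod := fun M => {i : ℤ | ¬ IsZero (M.component i)}.Finite

/-- The functor `M ↦ M i`. -/
def ev (i : ℤ) : A.GrMod ⥤ ModuleCat.{v} k :=
  A.isRightModule.ι ⋙ (evaluation _ _).obj (op ⟨i⟩)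

instance (i : ℤ) : PreservesFiniteLimits (A.ev i) :=
  have := preservesFiniteLimits_ι A.isRightModule
  comp_preservesFiniteLimits _ _

instance (i : ℤ) : PreservesFiniteColimits (A.ev i) :=
  have := preservesFiniteColimits_ι A.isRightModule
  comp_preservesFiniteColimits _ _

instance : A.isBounded.IsSerreClass where
  exists_zero := ⟨_, isZero_zero _, Set.finite_empty.subset fun i hi =>
    hi ((A.ev i).map_isZero (isZero_zero _))⟩
  prop_of_mono {M N} f _ h := h.subset fun i hi hN =>
    have : Mono ((A.ev i).map f) := A.mono_app f _
    hi (IsZero.of_mono (X := (A.ev i).obj M) (Y := (A.ev i).obj N) ((A.ev i).map f) hN)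
  prop_of_epi {M N} f _ h := h.subset fun i hi hM =>
    have : Epi ((A.ev i).map f) := A.epi_app f _
    hi (IsZero.of_epi (X := (A.ev i).obj M) (Y := (A.ev i).obj N) ((A.ev i).map f) hM)
  prop_X₂_of_shortExact {S} hS h₁ h₃ := (h₁.union h₃).subset fun i hi => by
    by_contra hc
    simp only [Set.mem_union, Set.mem_ofPred_eq, not_or, not_not] at hc
    exact hi (ObjectProperty.prop_X₂_of_shortExact IsZero (hS.map_of_exact (A.ev i)) hc.1 hc.2)

/-- The Serre subcategory `coh^b A` of `coh A` consisting of the bounded coherent modules. -/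
def cohBounded : ObjectProperty A.Coh := A.isBounded.inverseImage A.isCoherentModule.ι

instance : A.cohBounded.IsSerreClass :=
  have := preservesFiniteLimits_ι A.isCoherentModule
  have := preservesFiniteColimits_ι A.isCoherentModule
  inferInstanceAs (A.isBounded.inverseImage A.isCoherentModule.ι).IsSerreClass

end ZAlgebra

/-- The quotient of an abelian category by a Serre subcategory `P`: the localization at the
morphisms whose kernel and cokernel belong to `P`. -/
abbrev SerreQuotient {D : Type u} [Category.{v} D] [Abelian D] (P : ObjectProperty D)
    [P.IsSerreClass] := P.isoModSerre.Localization

/-- The category `cohproj A = coh A / coh^b A`. -/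
abbrev CohProj {k : Type v} [Field k] (A : ZAlgebra.{v} k) := SerreQuotient A.cohBounded

/-! ### Sequences of objects -/

section Sequences

variable (k : Type v) [Field k] {C : Type u} [Category.{v} C] [Abelian C] [Linear k C] (E : ℤ → C)

/-- The finiteness condition on a sequence: `Hom (E i, X)` is finite-dimensional for all `X`. -/
class IsHomFinite : Prop where
  finite : ∀ (i : ℤ) (X : C), Module.Finite k (E i ⟶ X)

variable {k} in
/-- A sequence is projective if every epimorphism `X ⟶ Y` induces surjections
`Hom (E i, X) → Hom (E i, Y)` for all `i` smaller than some `n`. -/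
class IsProjectiveSeq : Prop where
  exists_surjective : ∀ ⦃X Y : C⦄ (f : X ⟶ Y) [Epi f], ∃ n : ℤ, ∀ i < n,
    Function.Surjective (fun g : E i ⟶ X => g ≫ f)

/-- The canonical map `⨁_{j ∈ T} Hom (E j, X) ⊗ Hom (E i, E j) → Hom (E i, X)`. -/
def canonicalMap (T : Finset ℤ) (i : ℤ) (X : C) :
    (⨁ j : T, (E j ⟶ X) ⊗[k] (E i ⟶ E j)) →ₗ[k] (E i ⟶ X) :=
  DirectSum.toModule k T _ fun j => TensorProduct.lift (Linear.comp (E i) (E j) X).flip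

/-- A projective sequence is coherent if for all `X` and `m` there is a finite set `T` of integers
`≤ m` such that the canonical map is surjective for all `i` smaller than some `n`. -/
class IsCoherentSeq : Prop extends IsProjectiveSeq E where
  exists_finset : ∀ (X : C) (m : ℤ), ∃ T : Finset ℤ, (∀ j ∈ T, j ≤ m) ∧
    ∃ n : ℤ, ∀ i < n, Function.Surjective (canonicalMap k E T i X)

/-- The full subcategory `C₀` of the objects `X` with `Hom (E i, X) = 0` for all `i` smaller than
some `n`. -/
def nullObjects : ObjectProperty C := fun X => ∃ n : ℤ, ∀ i < n, ∀ f : E i ⟶ X, f = 0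

/-- A coherent sequence is ample if `C₀ = 0`. -/
class IsAmpleSeq : Prop extends IsCoherentSeq k E where
  isZero_of_null : ∀ X : C, nullObjects E X → IsZero X

instance [IsProjectiveSeq E] : (nullObjects E).IsSerreClass where
  exists_zero := ⟨_, isZero_zero _, 0, fun _ _ f => (isZero_zero C).eq_of_tgt _ _⟩
  prop_of_mono := by
    rintro X Y f _ ⟨n, hn⟩
    exact ⟨n, fun i hi g => by rw [← cancel_mono f, zero_comp]; exact hn i hi _⟩
  prop_of_epi := by
    rintro X Y f _ ⟨n, hn⟩
    obtain ⟨n', hn'⟩ := IsProjectiveSeq.exists_surjective (E := E) f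
    refine ⟨min n n', fun i hi g => ?_⟩
    obtain ⟨g', rfl⟩ := hn' i (lt_of_lt_of_le hi (min_le_right _ _)) g
    simp [hn i (lt_of_lt_of_le hi (min_le_left _ _)) g']
  prop_X₂_of_shortExact := by
    rintro S hS ⟨n, hn⟩ ⟨n', hn'⟩
    have := hS.mono_f
    refine ⟨min n n', fun i hi g => ?_⟩
    have h0 : g ≫ S.g = 0 := hn' i (lt_of_lt_of_le hi (min_le_right _ _)) _
    rw [← hS.exact.lift_f g h0, hn i (lt_of_lt_of_le hi (min_le_left _ _)) (hS.exact.lift g h0),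
      zero_comp]

/-! The `ℤ`-algebra `A(E)` of a sequence `E`, with components `A i j = Hom (E i, E j)` for `i < j`,
`A i i = k`, and `A i j = 0` for `j < i`. For a uniform description, an element of `A i j` is
recorded as a pair `(c, f)` in `k × Hom (E i, E j)`, where `c = 0` if `i < j`, where `f = c • 𝟙` if
`i = j`, and where `(c, f) = 0` if `j < i`. -/

/-- The component `A i j`: it is identified with `Hom (E i, E j)` through `(c, f) ↦ f` if `i < j`,
and with `k` through `(c, f) ↦ c` if `i = j`. -/
def seqComp (i j : ℤ) : Submodule k (k × (E i ⟶ E j)) where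
  carrier := {x | (i < j → x.1 = 0) ∧
    (∀ h : i = j, x.2 = x.1 • eqToHom (congrArg E h)) ∧ (j < i → x = 0)}
  add_mem' := by
    rintro x y ⟨hx₁, hx₂, hx₃⟩ ⟨hy₁, hy₂, hy₃⟩
    refine ⟨fun h => ?_, fun h => ?_, fun h => ?_⟩
    · simp [hx₁ h, hy₁ h]
    · simp [hx₂ h, hy₂ h, add_smul]
    · simp [hx₃ h, hy₃ h]
  zero_mem' := ⟨fun _ => rfl, fun _ => by simp, fun _ => rfl⟩
  smul_mem' := by
    rintro c x ⟨hx₁, hx₂, hx₃⟩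
    refine ⟨fun h => ?_, fun h => ?_, fun h => ?_⟩
    · simp [hx₁ h]
    · simp [hx₂ h, mul_smul]
    · simp [hx₃ h]

theorem mul_mem_seqComp {i j l : ℤ} (x : seqComp k E j l) (y : seqComp k E i j) :
    ((x.1.1 * y.1.1, y.1.2 ≫ x.1.2) : k × (E i ⟶ E l)) ∈ seqComp k E i l := by
  obtain ⟨⟨c, f⟩, hx₁, hx₂, hx₃⟩ := x
  obtain ⟨⟨d, g⟩, hy₁, hy₂, hy₃⟩ := y
  simp only [Prod.mk_eq_zero] at hx₁ hx₂ hx₃ hy₁ hy₂ hy₃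
  refine ⟨fun h => ?_, fun h => ?_, fun h => ?_⟩
  · rcases lt_or_ge i j with h' | h'
    · simp [hy₁ h']
    · simp [hx₁ (lt_of_le_of_lt h' h)]
  · subst h
    rcases lt_trichotomy i j with h' | h' | h'
    · simp [hx₃ h']
    · subst h'
      simp [hx₂ rfl, hy₂ rfl, smul_smul]
    · simp [hy₃ h']
  · rcases lt_or_ge j i with h' | h'
    · simp [hy₃ h']
    · simp [hx₃ (lt_of_lt_of_le h h')]

/-- The `ℤ`-algebra `A(E)` attached to a sequence `E`, with the multiplication induced by the
composition. -/
def algebraOf [IsHomFinite k E] : ZAlgebra.{v} k where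
  comp i j := seqComp k E i j
  comp_eq_zero {i j} h a := Subtype.ext (a.2.2.2 h)
  one i := ⟨(1, 𝟙 (E i)), fun h => absurd h (lt_irrefl i), fun _ => by simp,
    fun h => absurd h (lt_irrefl i)⟩
  smul_one_bijective i := by
    refine ⟨fun c d h => ?_, fun x => ⟨x.1.1, ?_⟩⟩
    · simpa using congrArg (fun t => t.1.1) h
    · refine Subtype.ext (Prod.ext ?_ ?_)
      · simp
      · simpa using (x.2.2.1 rfl).symm
  mul := LinearMap.mk₂ k (fun x y => ⟨(x.1.1 * y.1.1, y.1.2 ≫ x.1.2), mul_mem_seqComp k E x y⟩)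
    (fun x x' y => Subtype.ext (Prod.ext (add_mul _ _ _) (by simp)))
    (fun c x y => Subtype.ext (Prod.ext (smul_mul_assoc _ _ _) (by simp)))
    (fun x y y' => Subtype.ext (Prod.ext (mul_add _ _ _) (by simp)))
    (fun c x y => Subtype.ext (Prod.ext (mul_smul_comm _ _ _) (by simp)))
  one_mul a := Subtype.ext (Prod.ext (one_mul _) (Category.comp_id _))
  mul_one a := Subtype.ext (Prod.ext (mul_one _) (Category.id_comp _))
  mul_assoc a b c := Subtype.ext (Prod.ext (mul_assoc _ _ _) (Category.assoc _ _ _).symm)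
  finite i j :=
    have := IsHomFinite.finite (k := k) (E := E) i (E j)
    inferInstance

end Sequences

end NCProj

end

/-! Write Γ(X) = ⨁ Hom(E i, X), a graded right A-module (`sections`). Everything is decided in
degrees i ≪ 0.

Γ is left exact, and projectivity of E makes it exact in low degrees. Hence a morphism of C has
kernel and cokernel in C₀ exactly when Γ makes it bijective in low degrees
(`isoModSerre_nullObjects_iff`). Finitely generated modules vanish in large degrees and have
finite-dimensional components, so the same criterion describes coherent modules modulo bounded ones
(`isoModSerre_iff_isLowBijective`).

Condition (b) makes each truncation Γ(X)_{≤ m} finitely generated (`isFG_trunc_sections`); Γ(X)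
itself may be nonzero in arbitrarily large degrees. It follows that a finitely generated module
mapping to some Γ(X) injectively in low degrees is coherent (`isCoherentModule_of_injective`): the
kernel of a map to it from a finite sum of P j agrees in low degrees with Γ of a kernel taken in C.
This covers P j, S j and Γ(X)_{≤ m}.

Conversely, a presentation of a coherent M by finite sums of P j yields a morphism d between the
corresponding sums of E j. Then coker d represents Hom(M, Γ(-)), and M ⟶ Γ(coker d) is bijective in
low degrees (`exists_reflection_of_isCoherentModule`). So X ↦ Γ(X)_{≤ 0} is essentially surjective
onto cohproj A. Reflecting the vertex of a fraction of modules gives a fraction in C, whence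
fullness on C/C₀; a morphism that is killed has image in C₀, whence faithfulness. If C₀ = 0, the
quotient C/C₀ is C itself. -/

noncomputable section

namespace NCProj

namespace ZAlgebra

variable {k : Type v} [Field k] {A : ZAlgebra.{v} k}

/-! ### Components of morphisms of graded modules -/

/-- The component of degree `i` of a morphism of graded modules. -/
def app {M N : A.GrMod} (f : M ⟶ N) (i : ℤ) : M.component i →ₗ[k] N.component i :=
  (f.hom.app (op ⟨i⟩)).hom

@[simp]
theorem app_id (M : A.GrMod) (i : ℤ) (x : M.component i) : app (𝟙 M) i x = x := rfl

@[simp]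
theorem app_comp {M N L : A.GrMod} (f : M ⟶ N) (g : N ⟶ L) (i : ℤ) (x : M.component i) :
    app (f ≫ g) i x = app g i (app f i x) := rfl

@[simp]
theorem app_zero (M N : A.GrMod) (i : ℤ) (x : M.component i) : app (0 : M ⟶ N) i x = 0 := rfl

@[simp]
theorem app_add {M N : A.GrMod} (f g : M ⟶ N) (i : ℤ) (x : M.component i) :
    app (f + g) i x = app f i x + app g i x := rfl

theorem app_sum {M N : A.GrMod} {ι : Type*} (s : Finset ι) (f : ι → (M ⟶ N)) (i : ℤ)
    (x : M.component i) : app (∑ a ∈ s, f a) i x = ∑ a ∈ s, app (f a) i x := by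
  classical
  induction s using Finset.induction_on with
  | empty => simp
  | insert a s ha ih => simp [Finset.sum_insert ha, ih]

theorem app_act {M N : A.GrMod} (f : M ⟶ N) {i j : ℤ} (a : A.comp i j) (x : M.component j) :
    app f i (M.act a x) = N.act a (app f j x) :=
  congrArg (fun t => t.hom x)
    (f.hom.naturality (Quiver.Hom.op (X := (⟨i⟩ : A.Idx)) (Y := (⟨j⟩ : A.Idx)) a))

theorem hom_ext {M N : A.GrMod} {f g : M ⟶ N} (h : ∀ i x, app f i x = app g i x) : f = g := by
  ext i x
  exact h i.unop.deg x

theorem act_one (M : A.GrMod) {i : ℤ} (x : M.component i) : M.act (A.one i) x = x :=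
  congrArg (fun t => t.hom x) (M.obj.map_id (op ⟨i⟩))

theorem act_mul (M : A.GrMod) {i j l : ℤ} (a : A.comp j l) (b : A.comp i j)
    (x : M.component l) : M.act (A.mul a b) x = M.act b (M.act a x) :=
  congrArg (fun t => t.hom x)
    (M.obj.map_comp (Quiver.Hom.op (X := (⟨j⟩ : A.Idx)) (Y := (⟨l⟩ : A.Idx)) a)
      (Quiver.Hom.op (X := (⟨i⟩ : A.Idx)) (Y := (⟨j⟩ : A.Idx)) b))

theorem add_act (M : A.GrMod) {i j : ℤ} (a b : A.comp i j) (x : M.component j) :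
    M.act (a + b) x = M.act a x + M.act b x :=
  have := M.property.1
  congrArg (fun t => t.hom x) (M.obj.map_add
    (f := Quiver.Hom.op (X := (⟨i⟩ : A.Idx)) (Y := (⟨j⟩ : A.Idx)) a)
    (g := Quiver.Hom.op (X := (⟨i⟩ : A.Idx)) (Y := (⟨j⟩ : A.Idx)) b))

theorem smul_act (M : A.GrMod) {i j : ℤ} (r : k) (a : A.comp i j) (x : M.component j) :
    M.act (r • a) x = r • M.act a x :=
  congrArg (fun t => t.hom x) (M.property.2 (i := (⟨i⟩ : A.Idx)) (j := (⟨j⟩ : A.Idx)) a r)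

theorem act_eq_zero (M : A.GrMod) {i j : ℤ} (h : j < i) (a : A.comp i j) (x : M.component j) :
    M.act a x = 0 := by
  rw [A.comp_eq_zero h a, ← zero_smul k (0 : A.comp i j), smul_act, zero_smul]

/-- A morphism of graded modules given by its components. -/
def mkHom {M N : A.GrMod} (f : ∀ i, M.component i →ₗ[k] N.component i)
    (hf : ∀ {i j : ℤ} (a : A.comp i j) (x : M.component j),
      f i (M.act a x) = N.act a (f j x)) : M ⟶ N :=
  ObjectProperty.homMk
    { app := fun i => ModuleCat.ofHom (f i.unop.deg)
      naturality := fun i j a => by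
        ext x
        exact hf (i := j.unop.deg) (j := i.unop.deg) a.unop x }

@[simp]
theorem app_mkHom {M N : A.GrMod} (f : ∀ i, M.component i →ₗ[k] N.component i)
    (hf : ∀ {i j : ℤ} (a : A.comp i j) (x : M.component j),
      f i (M.act a x) = N.act a (f j x)) (i : ℤ) (x : M.component i) :
    app (mkHom f hf) i x = f i x := rfl

theorem app_injective_of_mono {M N : A.GrMod} (f : M ⟶ N) [Mono f] (i : ℤ) :
    Function.Injective (app f i) :=
  (ModuleCat.mono_iff_injective _).1 (A.mono_app f (op ⟨i⟩))

theorem app_surjective_of_epi {M N : A.GrMod} (f : M ⟶ N) [Epi f] (i : ℤ) :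
    Function.Surjective (app f i) :=
  (ModuleCat.epi_iff_surjective _).1 (A.epi_app f (op ⟨i⟩))

theorem epi_of_app_surjective {M N : A.GrMod} (f : M ⟶ N)
    (h : ∀ i, Function.Surjective (app f i)) : Epi f := by
  constructor
  intro L g g' hg
  refine hom_ext fun i y => ?_
  obtain ⟨x, rfl⟩ := h i y
  exact congrArg (fun t => app t i x) hg

theorem mono_of_app_injective {M N : A.GrMod} (f : M ⟶ N)
    (h : ∀ i, Function.Injective (app f i)) : Mono f := by
  constructor
  intro L g g' hg
  exact hom_ext fun i y => h i (congrArg (fun t => app t i y) hg)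

theorem isIso_of_app_bijective {M N : A.GrMod} (f : M ⟶ N)
    (h : ∀ i, Function.Bijective (app f i)) : IsIso f :=
  have := mono_of_app_injective f fun i => (h i).1
  have := epi_of_app_surjective f fun i => (h i).2
  isIso_of_mono_of_epi f

theorem exact_app {M N L : A.GrMod} (f : M ⟶ N) (g : N ⟶ L) (w : f ≫ g = 0)
    (h : (ShortComplex.mk f g w).Exact) (i : ℤ) (y : N.component i) (hy : app g i y = 0) :
    ∃ x, app f i x = y :=
  (ShortComplex.moduleCat_exact_iff _).1 (h.map (A.ev i)) y hy

/-- The morphism `P j ⟶ M` given by an element of `M j`. -/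
def projHom {M : A.GrMod} {j : ℤ} (x : M.component j) : A.proj j ⟶ M :=
  mkHom (fun i =>
    { toFun := fun a => M.act (show A.comp i j from a) x
      map_add' := fun a b => add_act M (show A.comp i j from a) (show A.comp i j from b) x
      map_smul' := fun r a => smul_act M r (show A.comp i j from a) x })
    fun _ _ => act_mul M _ _ x

variable (A) in
/-- The generator of `P j`. -/
def projOne (j : ℤ) : (A.proj j).component j := A.one j

@[simp]
theorem app_projHom_one {M : A.GrMod} {j : ℤ} (x : M.component j) :
    app (projHom x) j (A.projOne j) = x := act_one M x

theorem exists_act_projOne {i j : ℤ} (x : (A.proj j).component i) :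
    ∃ a : A.comp i j, x = (A.proj j).act a (A.projOne j) := ⟨x, (A.one_mul x).symm⟩

theorem proj_hom_ext {M : A.GrMod} {j : ℤ} {f g : A.proj j ⟶ M}
    (h : app f j (A.projOne j) = app g j (A.projOne j)) : f = g := by
  refine hom_ext fun i x => ?_
  obtain ⟨a, rfl⟩ := exists_act_projOne x
  rw [app_act, app_act, h]

/-! ### Finiteness of components -/

variable (A) in
/-- The modules with finite-dimensional components which vanish in large degrees. -/
def isLocallyFinite : ObjectProperty A.GrMod := fun M =>
  (∀ i, Module.Finite k (M.component i)) ∧ ∃ m : ℤ, ∀ i, m < i → ∀ x : M.component i, x = 0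

theorem isLocallyFinite_of_mono {M N : A.GrMod} (f : M ⟶ N) [Mono f]
    (h : A.isLocallyFinite N) : A.isLocallyFinite M := by
  obtain ⟨h₁, m, h₂⟩ := h
  refine ⟨fun i => ?_, m, fun i hi x => ?_⟩
  · have := h₁ i
    exact Module.Finite.of_injective _ (app_injective_of_mono f i)
  · exact app_injective_of_mono f i ((h₂ i hi _).trans (map_zero _).symm)

theorem isLocallyFinite_of_epi {M N : A.GrMod} (f : M ⟶ N) [Epi f]
    (h : A.isLocallyFinite M) : A.isLocallyFinite N := by
  obtain ⟨h₁, m, h₂⟩ := h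
  refine ⟨fun i => ?_, m, fun i hi y => ?_⟩
  · have := h₁ i
    exact Module.Finite.of_surjective _ (app_surjective_of_epi f i)
  · obtain ⟨x, rfl⟩ := app_surjective_of_epi f i y
    rw [h₂ i hi x, map_zero]

theorem biproduct_eq_sum {ι : Type} [Fintype ι] (M : ι → A.GrMod) (i : ℤ)
    (x : (⨁ M).component i) :
    x = ∑ a, app (biproduct.ι M a) i (app (biproduct.π M a) i x) := by
  have h := congrArg (fun t => app t i x) (biproduct.total (f := M))
  simp only [app_sum, app_comp, app_id] at h
  exact h.symm

theorem biproduct_ext {ι : Type} [Finite ι] (M : ι → A.GrMod) (i : ℤ)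
    {x y : (⨁ M).component i}
    (h : ∀ a, app (biproduct.π M a) i x = app (biproduct.π M a) i y) : x = y := by
  cases nonempty_fintype ι
  rw [biproduct_eq_sum M i x, biproduct_eq_sum M i y]
  simp [h]

theorem isLocallyFinite_of_isFreeFG {P : A.GrMod} (hP : A.isFreeFG P) :
    A.isLocallyFinite P := by
  obtain ⟨ι, _, j, ⟨e⟩⟩ := hP
  cases nonempty_fintype ι
  suffices h : A.isLocallyFinite (⨁ fun a => A.proj (j a)) from isLocallyFinite_of_mono e.hom h
  -- Any common upper bound of the `j a` serves; this one also makes sense for an empty index set.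
  refine ⟨fun i => ?_, ∑ a, |j a|, fun i hi x => ?_⟩
  · have (a : ι) : Module.Finite k ((A.proj (j a)).component i) := A.finite i (j a)
    exact Module.Finite.of_injective
      (LinearMap.pi fun a => app (biproduct.π (fun a => A.proj (j a)) a) i)
      fun x y h => biproduct_ext _ i fun a => congrFun h a
  · refine biproduct_ext _ i fun a => ?_
    have hlt : j a < i := (le_abs_self _).trans_lt
      ((Finset.single_le_sum (f := fun a => |j a|) (fun _ _ => abs_nonneg _)
        (Finset.mem_univ a)).trans_lt hi)
    exact (A.comp_eq_zero hlt _).trans (A.comp_eq_zero hlt _).symm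

theorem isLocallyFinite_of_isFG {M : A.GrMod} (hM : IsFG A.isFreeFG M) :
    A.isLocallyFinite M := by
  obtain ⟨P, hP, p, _⟩ := hM
  exact isLocallyFinite_of_epi p (isLocallyFinite_of_isFreeFG hP)

/-! ### Modules generated in given degrees -/

/-- There is a morphism from a finite direct sum of modules `P j` to `M` which is surjective in
the degrees belonging to `s`. -/
def GenOn (M : A.GrMod) (s : Set ℤ) : Prop :=
  ∃ (P : A.GrMod) (_ : A.isFreeFG P) (f : P ⟶ M), ∀ i ∈ s, Function.Surjective (app f i)

theorem GenOn.isFG {M : A.GrMod} (h : GenOn M Set.univ) : IsFG A.isFreeFG M := by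
  obtain ⟨P, hP, f, hf⟩ := h
  exact ⟨P, hP, f, epi_of_app_surjective f fun i => hf i trivial⟩

theorem GenOn.mono {M : A.GrMod} {s t : Set ℤ} (h : GenOn M t) (hst : s ⊆ t) : GenOn M s := by
  obtain ⟨P, hP, f, hf⟩ := h
  exact ⟨P, hP, f, fun i hi => hf i (hst hi)⟩

theorem GenOn.union {M : A.GrMod} {s t : Set ℤ} (hs : GenOn M s) (ht : GenOn M t) :
    GenOn M (s ∪ t) := by
  obtain ⟨P, hP, f, hf⟩ := hs
  obtain ⟨R, hR, g, hg⟩ := ht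
  refine ⟨P ⊞ R, A.isProjFamily.biprod _ _ hP hR, biprod.desc f g, ?_⟩
  rintro i (hi | hi) y
  · obtain ⟨x, rfl⟩ := hf i hi y
    exact ⟨app biprod.inl i x, by rw [← app_comp, biprod.inl_desc]⟩
  · obtain ⟨x, rfl⟩ := hg i hi y
    exact ⟨app biprod.inr i x, by rw [← app_comp, biprod.inr_desc]⟩

theorem GenOn.of_eq_zero {M : A.GrMod} {s : Set ℤ}
    (h : ∀ i ∈ s, ∀ x : M.component i, x = 0) : GenOn M s :=
  ⟨_, A.isProjFamily.zero _ (isZero_zero _), 0, fun i hi y =>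
    ⟨0, (map_zero _).trans (h i hi y).symm⟩⟩

/-- One copy of `P i` is used for each vector of a basis of `M i`, its generator being sent to that
vector. -/
theorem GenOn.singleton (M : A.GrMod) (i : ℤ) [Module.Finite k (M.component i)] :
    GenOn M {i} := by
  let b := Module.finBasis k (M.component i)
  refine ⟨_, ⟨_, inferInstance, fun _ => i, ⟨Iso.refl _⟩⟩,
    biproduct.desc fun a => projHom (b a), ?_⟩
  intro i' hi'
  obtain rfl : i' = i := hi'
  intro y
  refine ⟨∑ a, b.repr y a • app (biproduct.ι (fun _ => A.proj i') a) i' (A.projOne i'), ?_⟩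
  nth_rewrite 2 [← b.sum_repr y]
  rw [map_sum]
  refine Finset.sum_congr rfl fun a _ => ?_
  rw [map_smul, ← app_comp, biproduct.ι_desc, app_projHom_one]

theorem GenOn.of_finite {M : A.GrMod} (hM : ∀ i, Module.Finite k (M.component i)) {s : Set ℤ}
    (hs : s.Finite) : GenOn M s := by
  induction s, hs using Set.Finite.induction_on with
  | empty => exact GenOn.of_eq_zero fun i hi => hi.elim
  | @insert a s _ _ ih =>
    have := hM a
    exact (GenOn.singleton M a).union ih

/-- Between `n` and the degree above which `M` vanishes there are only finitely many degrees, each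
with a finite-dimensional component. Finite generation is thus a question about low degrees. -/
theorem IsFG.of_genOn {M : A.GrMod} (hM : A.isLocallyFinite M) {n : ℤ}
    (h : GenOn M (Set.Iio n)) : IsFG A.isFreeFG M := by
  obtain ⟨h₁, m, h₂⟩ := hM
  refine (((GenOn.of_finite h₁ (Set.finite_Icc n m)).union h).union
    (GenOn.of_eq_zero (s := Set.Ioi m) fun i hi => h₂ i hi)).mono (fun i _ => ?_) |>.isFG
  simp only [Set.mem_union, Set.mem_Icc, Set.mem_Iio, Set.mem_Ioi]
  lia

/-! ### Truncation -/

/-- The submodule `M_{≤ m}` of `M` in degree `i`. -/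
def truncComponent (m : ℤ) (M : A.GrMod) (i : ℤ) : Submodule k (M.component i) where
  carrier := {x | m < i → x = 0}
  add_mem' ha hb h := by simp [ha h, hb h]
  zero_mem' _ := rfl
  smul_mem' c x hx h := by simp [hx h]

/-- `A i j` vanishes unless `i ≤ j`, so the action never raises degrees. -/
theorem act_mem_truncComponent {m : ℤ} {M : A.GrMod} {i j : ℤ} (a : A.comp i j)
    {x : M.component j} (hx : x ∈ truncComponent m M j) :
    M.act a x ∈ truncComponent m M i := by
  intro hi
  rcases lt_or_ge j i with h | h
  · exact act_eq_zero M h a x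
  · rw [hx (hi.trans_le h), map_zero]

/-- The truncation `M_{≤ m}`. -/
def truncObj (m : ℤ) (M : A.GrMod) : A.GrMod :=
  ⟨{ obj := fun i => ModuleCat.of k (truncComponent m M i.unop.deg)
     map := fun {i j} a => ModuleCat.ofHom
      ((M.act (i := j.unop.deg) (j := i.unop.deg) a.unop).hom.restrict
        fun _ hx => act_mem_truncComponent _ hx)
     map_id := fun i => by
      ext x
      exact act_one M x.1
     map_comp := fun {i j l} a b => by
      ext x
      exact act_mul M (i := l.unop.deg) (j := j.unop.deg) (l := i.unop.deg) a.unop b.unop x.1 },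
   ⟨⟨fun {X Y a b} => by
      ext x
      exact add_act M (i := Y.unop.deg) (j := X.unop.deg) a.unop b.unop x.1⟩,
    fun i j a r => by
      ext x
      exact smul_act M (i := i.deg) (j := j.deg) r a x.1⟩⟩

/-- The inclusion `M_{≤ m} ⟶ M`. -/
def truncι (m : ℤ) (M : A.GrMod) : truncObj m M ⟶ M :=
  mkHom (fun i => (truncComponent m M i).subtype) fun _ _ => rfl

theorem truncι_injective (m : ℤ) (M : A.GrMod) (i : ℤ) :
    Function.Injective (app (truncι m M) i) := Subtype.val_injective

instance (m : ℤ) (M : A.GrMod) : Mono (truncι m M) :=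
  mono_of_app_injective _ (truncι_injective m M)

theorem truncι_bijective (m : ℤ) (M : A.GrMod) {i : ℤ} (hi : i ≤ m) :
    Function.Bijective (app (truncι m M) i) :=
  ⟨Subtype.val_injective, fun x => ⟨⟨x, fun h => absurd h hi.not_gt⟩, rfl⟩⟩

theorem truncObj_eq_zero (m : ℤ) (M : A.GrMod) {i : ℤ} (hi : m < i)
    (x : (truncObj m M).component i) : x = 0 := Subtype.ext (x.2 hi)

variable (A) in
/-- The truncation functor `M ↦ M_{≤ m}`. -/
def trunc (m : ℤ) : A.GrMod ⥤ A.GrMod where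
  obj M := truncObj m M
  map {M N} f := mkHom (fun i => (app f i).restrict (p := truncComponent m M i)
      (q := truncComponent m N i) fun x hx h => by rw [hx h, map_zero])
    fun a x => Subtype.ext (app_act f a x.1)

theorem trunc_map_bijective (m : ℤ) {M N : A.GrMod} (f : M ⟶ N) {i : ℤ}
    (h : i ≤ m → Function.Bijective (app f i)) :
    Function.Bijective (app ((A.trunc m).map f) i) := by
  rcases le_or_gt i m with hi | hi
  · have h' : Function.Bijective (app (truncι m N) i ∘ app ((A.trunc m).map f) i) :=
      (h hi).comp (truncι_bijective m M hi)
    exact (Function.Bijective.of_comp_iff' (truncι_bijective m N hi) _).1 h'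
  · exact ⟨fun x y _ => (truncObj_eq_zero m M hi x).trans (truncObj_eq_zero m M hi y).symm,
      fun y => ⟨0, (map_zero _).trans (truncObj_eq_zero m N hi y).symm⟩⟩

theorem isLocallyFinite_truncObj (m : ℤ) {M : A.GrMod}
    (hM : ∀ i, Module.Finite k (M.component i)) : A.isLocallyFinite (truncObj m M) :=
  ⟨fun i => have := hM i
    Module.Finite.of_injective _ (truncι_injective m M i), m, fun _ hi => truncObj_eq_zero m M hi⟩

theorem isFG_of_bounded {M : A.GrMod} (hM : A.isLocallyFinite M) {n : ℤ}
    (h : ∀ i < n, ∀ x : M.component i, x = 0) : IsFG A.isFreeFG M :=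
  IsFG.of_genOn hM (GenOn.of_eq_zero (s := Set.Iio n) h)

/-! ### Morphisms which are bijective in small degrees -/

/-- A morphism which is bijective in all sufficiently small degrees. -/
def IsLowBijective {M N : A.GrMod} (f : M ⟶ N) : Prop :=
  ∃ n : ℤ, ∀ i < n, Function.Bijective (app f i)

theorem isZero_component_iff {M : A.GrMod} {i : ℤ} :
    IsZero (M.component i) ↔ ∀ x : M.component i, x = 0 := by
  rw [ModuleCat.isZero_iff_subsingleton]
  exact ⟨fun h x => Subsingleton.elim _ _, fun h => ⟨fun x y => (h x).trans (h y).symm⟩⟩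

/-- Vanishing in large degrees is automatic here, so only the lower bound is a condition. -/
theorem isBounded_iff {M : A.GrMod} (hM : A.isLocallyFinite M) :
    A.isBounded M ↔ ∃ n : ℤ, ∀ i < n, ∀ x : M.component i, x = 0 := by
  constructor
  · intro h
    obtain ⟨n, hn⟩ := h.bddBelow
    refine ⟨n, fun i hi => ?_⟩
    rw [← isZero_component_iff]
    by_contra hc
    exact absurd (hn hc) hi.not_ge
  · rintro ⟨n, hn⟩
    obtain ⟨-, m, hm⟩ := hM
    refine (Set.finite_Icc n m).subset fun i hi => ?_
    simp only [Set.mem_ofPred_eq, isZero_component_iff] at hi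
    exact ⟨not_lt.1 fun h => hi (hn i h), not_lt.1 fun h => hi (hm i h)⟩

theorem mono_hom {M N : A.Coh} (f : M ⟶ N) [Mono f] : Mono f.hom :=
  have := A.isCoherentModule.preservesMonomorphisms_ι_of_isNormalEpiCategory
  inferInstanceAs (Mono (A.isCoherentModule.ι.map f))

theorem epi_hom {M N : A.Coh} (f : M ⟶ N) [Epi f] : Epi f.hom :=
  have := A.isCoherentModule.preservesEpimorphisms_ι_of_isNormalMonoCategory
  inferInstanceAs (Epi (A.isCoherentModule.ι.map f))

theorem exact_hom {S : ShortComplex A.Coh} (hS : S.Exact) (i : ℤ)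
    (y : S.X₂.obj.component i) (hy : app S.g.hom i y = 0) : ∃ x, app S.f.hom i x = y :=
  have := preservesFiniteLimits_ι A.isCoherentModule
  have := preservesFiniteColimits_ι A.isCoherentModule
  exact_app _ _ _ (hS.map A.isCoherentModule.ι) i y hy

theorem cohBounded_iff (M : A.Coh) :
    A.cohBounded M ↔ ∃ n : ℤ, ∀ i < n, ∀ x : M.obj.component i, x = 0 :=
  isBounded_iff (isLocallyFinite_of_isFG M.property.1)

/-- Kernels and cokernels of coherent modules are computed degree by degree, and a coherent module
is bounded as soon as it vanishes in low degrees. -/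
theorem isoModSerre_iff_isLowBijective {M N : A.Coh} (f : M ⟶ N) :
    A.cohBounded.isoModSerre f ↔ IsLowBijective f.hom := by
  rw [ObjectProperty.isoModSerre_iff, ObjectProperty.monoModSerre_iff,
    ObjectProperty.epiModSerre_iff, cohBounded_iff, cohBounded_iff]
  have hk : ∀ i x, app f.hom i (app (kernel.ι f).hom i x) = 0 := fun i x =>
    congrArg (fun t => app t.hom i x) (kernel.condition f)
  have hc : ∀ i x, app (cokernel.π f).hom i (app f.hom i x) = 0 := fun i x =>
    congrArg (fun t => app t.hom i x) (cokernel.condition f)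
  have hm := mono_hom (kernel.ι f)
  have he := epi_hom (cokernel.π f)
  constructor
  · rintro ⟨⟨n, hn⟩, n', hn'⟩
    refine ⟨min n n', fun i hi => ⟨?_, fun y => ?_⟩⟩
    · refine (injective_iff_map_eq_zero (app f.hom i)).2 fun x hx => ?_
      obtain ⟨z, rfl⟩ := exact_hom (ShortComplex.exact_kernel f) i x hx
      rw [hn i (hi.trans_le (min_le_left _ _)) z]
      exact map_zero _
    · exact exact_hom (ShortComplex.exact_cokernel f) i y
        (hn' i (hi.trans_le (min_le_right _ _)) _)
  · rintro ⟨n, hn⟩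
    refine ⟨⟨n, fun i hi x => ?_⟩, n, fun i hi y => ?_⟩
    · apply app_injective_of_mono (kernel.ι f).hom i
      apply (hn i hi).1
      rw [hk, map_zero, map_zero]
    · obtain ⟨y, rfl⟩ := app_surjective_of_epi (cokernel.π f).hom i y
      obtain ⟨x, rfl⟩ := (hn i hi).2 y
      exact hc i x

theorem isIso_Q_map {M N : A.Coh} (f : M ⟶ N) (hf : IsLowBijective f.hom) :
    IsIso (A.cohBounded.isoModSerre.Q.map f) :=
  Localization.inverts _ _ f ((isoModSerre_iff_isLowBijective f).2 hf)

end ZAlgebra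

open ZAlgebra

/-- A Serre quotient by a Serre subcategory consisting of zero objects is an equivalence. -/
theorem exists_equivalence_of_isZero (k : Type v) [Field k] {C : Type u} [Category.{v} C]
    [Abelian C] [Linear k C] (P : ObjectProperty C) [P.IsSerreClass]
    (h : ∀ X, P X → IsZero X) :
    ∃ e : C ≌ SerreQuotient P, e.functor.Additive ∧ e.functor.Linear k := by
  have hW : P.isoModSerre ≤ MorphismProperty.isomorphisms C := by
    rintro X Y f ⟨h₁, h₂⟩
    have := Preadditive.mono_of_isZero_kernel f (h _ h₁)
    have := Preadditive.epi_of_isZero_cokernel f (h _ h₂)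
    exact isIso_of_mono_of_epi f
  -- The morphisms to be inverted are already invertible, so `C` is its own localization; uniqueness
  -- of localizations gives the equivalence.
  have := Functor.IsLocalization.for_id P.isoModSerre hW
  let e := Localization.uniq (𝟭 C) P.isoModSerre.Q P.isoModSerre
  have i : P.isoModSerre.Q ≅ e.functor :=
    (Localization.compUniqFunctor (𝟭 C) P.isoModSerre.Q P.isoModSerre).symm ≪≫
      e.functor.leftUnitor
  have : e.functor.Additive := Functor.additive_of_iso i
  exact ⟨e, this, Functor.linear_of_iso k i⟩

variable (k : Type v) [Field k] {C : Type u} [Category.{v} C] [Abelian C] [Linear k C] (E : ℤ → C)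
  [IsHomFinite k E]

/-! ### The modules of sections -/

variable {k E} in
/-- The morphism `E i ⟶ E j` given by an element of `A i j`. -/
def homOf {i j : ℤ} : (algebraOf k E).comp i j →ₗ[k] (E i ⟶ E j) :=
  LinearMap.snd k k (E i ⟶ E j) ∘ₗ (seqComp k E i j).subtype

theorem homOf_one (i : ℤ) : homOf ((algebraOf k E).one i) = 𝟙 (E i) := rfl

variable {k E} in
theorem homOf_mul {i j l : ℤ} (a : (algebraOf k E).comp j l) (b : (algebraOf k E).comp i j) :
    homOf ((algebraOf k E).mul a b) = homOf b ≫ homOf a := rfl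

/-- The strict inequality matters: `A i i` is only `k`, and `A i j` is zero for `j < i`. This is why
`P j` is compared with the sections of `E j` only in degrees below `j`. -/
theorem homOf_bijective {i j : ℤ} (h : i < j) :
    Function.Bijective (homOf : (algebraOf k E).comp i j → (E i ⟶ E j)) := by
  refine ⟨fun a b hab => Subtype.ext (Prod.ext ?_ hab), fun f => ⟨⟨(0, f), fun _ => rfl,
    fun h' => absurd h' h.ne, fun h' => absurd h' h.not_gt⟩, rfl⟩⟩
  rw [a.2.1 h, b.2.1 h]

/-- The functor from the category attached to `A(E)` given by the sequence `E`. -/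
def seqFunctor : (algebraOf k E).Idx ⥤ C where
  obj i := E i.deg
  map {i j} a := homOf (k := k) (E := E) (i := i.deg) (j := j.deg) a
  map_id i := homOf_one k E i.deg
  map_comp {i j l} a b := homOf_mul (k := k) (i := i.deg) (j := j.deg) (l := l.deg) b a

/-- The functor `X ↦ ⨁ i, Hom (E i, X)`. -/
def sections : C ⥤ (algebraOf k E).GrMod :=
  ObjectProperty.lift _
    (linearYoneda k C ⋙ (Functor.whiskeringLeft _ _ _).obj (seqFunctor k E).op) fun X =>
    ⟨⟨fun {Y Z a b} => by
      ext x
      exact (congrArg (· ≫ (show E Y.unop.deg ⟶ X from x)) (map_add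
        (homOf (k := k) (E := E) (i := Z.unop.deg) (j := Y.unop.deg)) a.unop b.unop)).trans
        (Preadditive.add_comp _ _ _ _ _ _)⟩,
    fun i j a r => by
      ext x
      exact (congrArg (· ≫ (show E j.deg ⟶ X from x)) (map_smul
        (homOf (k := k) (E := E) (i := i.deg) (j := j.deg)) r a)).trans
        (Linear.smul_comp _ _ _ _ _ _)⟩

variable {E} in
/-- The components of the module of sections. -/
def sec {X : C} {i : ℤ} : ((sections k E).obj X).component i ≃ₗ[k] (E i ⟶ X) :=
  LinearEquiv.refl k _

variable {k E}

@[simp]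
theorem sec_app_map {X Y : C} (f : X ⟶ Y) {i : ℤ} (x : ((sections k E).obj X).component i) :
    sec k (app ((sections k E).map f) i x) = sec k x ≫ f := rfl

@[simp]
theorem sec_act {X : C} {i j : ℤ} (a : (algebraOf k E).comp i j)
    (x : ((sections k E).obj X).component j) :
    sec k (((sections k E).obj X).act a x) = homOf a ≫ sec k x := rfl

variable (k E)

instance : (sections k E).Additive where
  map_add := hom_ext fun _ _ => (sec k).injective (Preadditive.comp_add _ _ _ _ _ _)

theorem sections_map_smul {X Y : C} (r : k) (f : X ⟶ Y) :
    (sections k E).map (r • f) = r • (sections k E).map f :=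
  hom_ext fun _ _ => (sec k).injective (Linear.comp_smul _ _ _ _ _ _)

instance (X : C) (i : ℤ) : Module.Finite k (((sections k E).obj X).component i) :=
  IsHomFinite.finite i X

variable {k E} in
theorem sections_map_injective_of_mono {X Y : C} (f : X ⟶ Y) [Mono f] (i : ℤ) :
    Function.Injective (app ((sections k E).map f) i) := fun _ _ h =>
  (sec k).injective ((cancel_mono f).1 (congrArg (sec k) h))

theorem exists_sections_map_surjective [IsProjectiveSeq E] {X Y : C} (f : X ⟶ Y) [Epi f] :
    ∃ n : ℤ, ∀ i < n, Function.Surjective (app ((sections k E).map f) i) :=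
  IsProjectiveSeq.exists_surjective (E := E) f

variable {k E} in
-- Left exactness of Hom, valid in every degree and without projectivity of the sequence.
theorem sections_exact {X Y Z : C} (f : X ⟶ Y) [Mono f] (g : Y ⟶ Z) (w : f ≫ g = 0)
    (h : (ShortComplex.mk f g w).Exact) {i : ℤ} (y : ((sections k E).obj Y).component i)
    (hy : app ((sections k E).map g) i y = 0) : ∃ x, app ((sections k E).map f) i x = y := by
  have hy' : sec k y ≫ g = 0 := congrArg (sec k) hy
  have : Mono (ShortComplex.mk f g w).f := inferInstanceAs (Mono f)
  exact ⟨(sec k).symm (h.lift (sec k y) hy'), (sec k).injective (h.lift_f (sec k y) hy')⟩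

/-- If `X ⟶ Y ⟶ Z` is exact, then so are the sections in all sufficiently small degrees. -/
theorem exists_sections_exact [IsProjectiveSeq E] {X Y Z : C} (f : X ⟶ Y) (g : Y ⟶ Z)
    (w : f ≫ g = 0) (h : (ShortComplex.mk f g w).Exact) :
    ∃ n : ℤ, ∀ i < n, ∀ y, app ((sections k E).map g) i y = 0 →
      ∃ x, app ((sections k E).map f) i x = y := by
  -- Exactness says that `X` maps onto the kernel of `g`; projectivity is applied to this
  -- epimorphism, left exactness does the rest.
  have hf : Epi (kernel.lift g f w) := h.epi_kernelLift
  obtain ⟨n, hn⟩ := exists_sections_map_surjective k E (kernel.lift g f w)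
  refine ⟨n, fun i hi y hy => ?_⟩
  obtain ⟨z, rfl⟩ := sections_exact (kernel.ι g) g (kernel.condition g)
    (ShortComplex.exact_kernel g) y hy
  obtain ⟨x, rfl⟩ := hn i hi z
  exact ⟨x, by rw [← app_comp, ← Functor.map_comp, kernel.lift_ι]⟩

theorem nullObjects_iff (X : C) : nullObjects E X ↔
    ∃ n : ℤ, ∀ i < n, ∀ x : ((sections k E).obj X).component i, x = 0 := Iff.rfl

/-- The kernel is controlled in all degrees by left exactness, the cokernel only in low degrees, by
projectivity. -/
theorem isoModSerre_nullObjects_iff [IsProjectiveSeq E] {X Y : C} (f : X ⟶ Y) :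
    (nullObjects E).isoModSerre f ↔ IsLowBijective ((sections k E).map f) := by
  rw [ObjectProperty.isoModSerre_iff, ObjectProperty.monoModSerre_iff,
    ObjectProperty.epiModSerre_iff, nullObjects_iff k, nullObjects_iff k]
  constructor
  · rintro ⟨⟨n₁, h₁⟩, n₂, h₂⟩
    obtain ⟨n₃, h₃⟩ := exists_sections_exact k E f (cokernel.π f) (cokernel.condition f)
      (ShortComplex.exact_cokernel f)
    refine ⟨min n₁ (min n₂ n₃), fun i hi => ?_⟩
    simp only [lt_min_iff] at hi
    refine ⟨(injective_iff_map_eq_zero (app ((sections k E).map f) i)).2 fun x hx => ?_,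
      fun y => h₃ i hi.2.2 y (h₂ i hi.2.1 _)⟩
    obtain ⟨z, rfl⟩ := sections_exact (kernel.ι f) f (kernel.condition f)
      (ShortComplex.exact_kernel f) x hx
    rw [h₁ i hi.1 z, map_zero]
  · rintro ⟨n, hn⟩
    obtain ⟨n', hn'⟩ := exists_sections_map_surjective k E (cokernel.π f)
    refine ⟨⟨n, fun i hi x => ?_⟩, min n n', fun i hi y => ?_⟩
    · apply sections_map_injective_of_mono (kernel.ι f) i
      apply (hn i hi).1
      rw [← app_comp, ← Functor.map_comp, kernel.condition, Functor.map_zero, app_zero, map_zero,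
        map_zero]
    · simp only [lt_min_iff] at hi
      obtain ⟨z, rfl⟩ := hn' i hi.2 y
      obtain ⟨x, rfl⟩ := (hn i hi.1).2 z
      rw [← app_comp, ← Functor.map_comp, cokernel.condition, Functor.map_zero, app_zero]

/-- The truncated modules of sections are finitely generated. -/
theorem isFG_trunc_sections [IsCoherentSeq k E] (X : C) (m : ℤ) :
    IsFG (algebraOf k E).isFreeFG (truncObj m ((sections k E).obj X)) := by
  obtain ⟨T, hT, n, hn⟩ := IsCoherentSeq.exists_finset (k := k) (E := E) X m
  have hfin : (algebraOf k E).isLocallyFinite (truncObj m ((sections k E).obj X)) :=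
    isLocallyFinite_truncObj m inferInstance
  obtain ⟨b, hb⟩ := T.bddBelow
  -- `P` generates the truncation in the finitely many degrees of `T`. Condition (b) says that these
  -- degrees generate all lower ones.
  obtain ⟨P, hP, f, hf⟩ := GenOn.of_finite hfin.1 T.finite_toSet
  -- Below the lower bound `b` of `T` one has `i < j` for every `j ∈ T`, so each morphism `E i ⟶ E
  -- j` comes from an element of `A i j`.
  refine IsFG.of_genOn (n := min n b) hfin ⟨P, hP, f, fun i hi y => ?_⟩
  simp only [Set.mem_Iio, lt_min_iff] at hi
  have key : ∀ z : ⨁ j : T, (E j ⟶ X) ⊗[k] (E i ⟶ E j),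
      canonicalMap k E T i X z ∈ LinearMap.range
        ((sec k).toLinearMap ∘ₗ app (truncι m ((sections k E).obj X)) i ∘ₗ app f i) := by
    intro z
    induction z using DirectSum.induction_on with
    | zero => rw [map_zero]; exact zero_mem _
    | add z z' h h' => rw [map_add]; exact add_mem h h'
    | of j t =>
      have hj : canonicalMap k E T i X (DirectSum.of _ j t) =
          TensorProduct.lift (Linear.comp (E i) (E j) X).flip t :=
        DirectSum.toModule_lof k (M := fun j : T => (E j ⟶ X) ⊗[k] (E i ⟶ E j)) j t
      rw [hj]
      induction t using TensorProduct.induction_on with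
      | zero => rw [map_zero]; exact zero_mem _
      | add t t' h h' =>
        rw [map_add]
        refine add_mem (h ?_) (h' ?_) <;>
        exact DirectSum.toModule_lof k (M := fun j : T => (E j ⟶ X) ⊗[k] (E i ⟶ E j)) j _
      | tmul g a =>
        obtain ⟨a, rfl⟩ := (homOf_bijective k E (hi.2.trans_le (hb j.2))).2 a
        obtain ⟨y, hy⟩ := (truncι_bijective m ((sections k E).obj X) (hT j j.2)).2
          ((sec k).symm g)
        obtain ⟨x, rfl⟩ := hf j j.2 y
        refine ⟨P.act a x, ?_⟩
        simp only [LinearMap.comp_apply, app_act, hy]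
        exact (sec_act a _).trans (by simp)
  obtain ⟨z, hz⟩ := hn i hi.1 (sec k (app (truncι m ((sections k E).obj X)) i y))
  obtain ⟨x, hx⟩ := key z
  rw [hz] at hx
  exact ⟨x, truncι_injective _ _ i ((sec k).injective hx)⟩

/-! ### Reflections of graded modules into `C` -/

/-- A morphism from a module to a module of sections is a reflection if it is universal. -/
structure IsReflection {M : (algebraOf k E).GrMod} {X : C} (η : M ⟶ (sections k E).obj X) :
    Prop where
  exists_desc : ∀ ⦃Y : C⦄ (h : M ⟶ (sections k E).obj Y), ∃ u : X ⟶ Y,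
    η ≫ (sections k E).map u = h
  eq_zero : ∀ ⦃Y : C⦄ (u : X ⟶ Y), η ≫ (sections k E).map u = 0 → u = 0

/-- By Yoneda, Hom(P j, Γ(Y)) = Γ(Y)_j = Hom(E j, Y), so `P j` is reflected to `E j`, and finite
sums to finite sums. The unit is bijective in the degrees below all the `j a`. -/
theorem exists_isReflection_of_isFreeFG {P : (algebraOf k E).GrMod}
    (hP : (algebraOf k E).isFreeFG P) : ∃ (X : C) (η : P ⟶ (sections k E).obj X),
      IsReflection k E η ∧ IsLowBijective η := by
  obtain ⟨ι, _, j, ⟨e⟩⟩ := hP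
  suffices h : ∃ (X : C) (η : (⨁ fun a => (algebraOf k E).proj (j a)) ⟶ (sections k E).obj X),
      IsReflection k E η ∧ IsLowBijective η by
    obtain ⟨X, η, hη, n, hn⟩ := h
    refine ⟨X, e.hom ≫ η, ⟨fun Y h => ?_, fun Y u hu => ?_⟩, n, fun i hi => ?_⟩
    · obtain ⟨u, hu⟩ := hη.exists_desc (e.inv ≫ h)
      exact ⟨u, by rw [Category.assoc, hu, e.hom_inv_id_assoc]⟩
    · refine hη.eq_zero u ?_
      rwa [Category.assoc, ← cancel_epi e.inv, e.inv_hom_id_assoc, comp_zero] at hu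
    · exact (hn i hi).comp ⟨app_injective_of_mono e.hom i, app_surjective_of_epi e.hom i⟩
  have : HasFiniteBiproducts C := Abelian.hasFiniteBiproducts
  cases nonempty_fintype ι
  let p (a : ι) : (algebraOf k E).proj (j a) ⟶ (sections k E).obj (E (j a)) :=
    projHom ((sec k).symm (𝟙 (E (j a))))
  let η : (⨁ fun a => (algebraOf k E).proj (j a)) ⟶
      (sections k E).obj (⨁ fun a => E (j a)) :=
    biproduct.desc fun a => p a ≫ (sections k E).map (biproduct.ι (fun a => E (j a)) a)
  have hι (a : ι) : biproduct.ι _ a ≫ η =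
      p a ≫ (sections k E).map (biproduct.ι (fun a => E (j a)) a) := biproduct.ι_desc _ _
  -- `η` is diagonal, so its bijectivity can be checked on each summand.
  have hπ (a : ι) : η ≫ (sections k E).map (biproduct.π (fun a => E (j a)) a) =
      biproduct.π _ a ≫ p a := by
    apply biproduct.hom_ext'
    intro b
    rw [reassoc_of% hι b, ← Functor.map_comp]
    by_cases hab : b = a
    · subst hab
      simp
    · rw [biproduct.ι_π_ne _ hab, biproduct.ι_π_ne_assoc _ hab]
      simp
  have hp {Y : C} (a : ι) (u : E (j a) ⟶ Y) :
      p a ≫ (sections k E).map u = projHom ((sec k).symm u) := by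
    apply proj_hom_ext
    rw [app_comp, app_projHom_one, app_projHom_one]
    exact (sec k).injective (Category.id_comp u)
  have hsec (a : ι) (i : ℤ) (c : (algebraOf k E).comp i (j a)) :
      sec k (app (p a) i (((algebraOf k E).proj (j a)).act c ((algebraOf k E).projOne (j a)))) =
        homOf c := by
    rw [app_act, app_projHom_one, sec_act]
    exact Category.comp_id _
  have hbij (a : ι) (i : ℤ) (hi : i < j a) : Function.Bijective (app (p a) i) := by
    constructor
    · intro x y h
      obtain ⟨x, rfl⟩ := exists_act_projOne x
      obtain ⟨y, rfl⟩ := exists_act_projOne y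
      have h' := congrArg (sec k) h
      rw [hsec, hsec] at h'
      rw [(homOf_bijective k E hi).1 h']
    · intro g
      obtain ⟨c, hc⟩ := (homOf_bijective k E hi).2 (sec k g)
      exact ⟨_, (sec k).injective ((hsec a i c).trans hc)⟩
  refine ⟨⨁ fun a => E (j a), η, ⟨fun Y h => ?_, fun Y u hu => ?_⟩, ?_⟩
  · refine ⟨biproduct.desc fun a => sec k (app (biproduct.ι _ a ≫ h) (j a)
      ((algebraOf k E).projOne (j a))), biproduct.hom_ext' _ _ fun a => ?_⟩
    rw [reassoc_of% hι a, ← Functor.map_comp, biproduct.ι_desc, hp]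
    apply proj_hom_ext
    rw [app_projHom_one, LinearEquiv.symm_apply_apply]
  · apply biproduct.hom_ext'
    intro a
    have h := congrArg (fun t => biproduct.ι _ a ≫ t) hu
    simp only [reassoc_of% hι a, ← Functor.map_comp, comp_zero, hp] at h
    have h' := congrArg (fun t => sec k (app t (j a) ((algebraOf k E).projOne (j a)))) h
    simpa using h'
  · obtain ⟨n, hn⟩ := (Set.finite_range j).bddBelow
    refine ⟨n, fun i hi => ?_⟩
    have hi' (a : ι) : i < j a := hi.trans_le (hn ⟨a, rfl⟩)
    constructor
    · intro x y hxy
      refine biproduct_ext _ i fun a => (hbij a i (hi' a)).1 ?_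
      rw [← app_comp, ← app_comp, ← hπ, app_comp, app_comp, hxy]
    · intro g
      choose c hc using fun a => (hbij a i (hi' a)).2
        (app ((sections k E).map (biproduct.π (fun a => E (j a)) a)) i g)
      refine ⟨∑ a, app (biproduct.ι _ a) i (c a), (sec k).injective ?_⟩
      rw [map_sum, map_sum]
      simp only [← app_comp, hι]
      simp only [app_comp, hc, sec_app_map, Category.assoc]
      rw [← Preadditive.comp_sum, biproduct.total, Category.comp_id]

/-! ### Coherence of the algebra -/

variable {k E} in
-- Γ preserves kernels: the factorizations through `kernel u` in the various degrees are linear and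
-- compatible with the action because `kernel.ι u` is a monomorphism.
theorem exists_sections_lift {M : (algebraOf k E).GrMod} {Y Z : C}
    (h : M ⟶ (sections k E).obj Y) (u : Y ⟶ Z) (w : h ≫ (sections k E).map u = 0) :
    ∃ r : M ⟶ (sections k E).obj (kernel u), r ≫ (sections k E).map (kernel.ι u) = h := by
  have w' (i : ℤ) (x : M.component i) : sec k (app h i x) ≫ u = 0 :=
    congrArg (fun t => sec k (app t i x)) w
  refine ⟨mkHom (fun i =>
    { toFun := fun x => (sec k).symm (kernel.lift u (sec k (app h i x)) (w' i x))
      map_add' := fun x y => ?_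
      map_smul' := fun c x => ?_ }) fun a x => ?_, hom_ext fun i x => (sec k).injective ?_⟩
  · apply (sec k).injective
    rw [← cancel_mono (kernel.ι u)]
    simp
  · apply (sec k).injective
    rw [← cancel_mono (kernel.ι u)]
    simp
  · apply (sec k).injective
    rw [← cancel_mono (kernel.ι u)]
    simp [app_act]
  · simp

/-- The composite `P ⟶ N ⟶ Γ(X)` comes from some `u : Y ⟶ X`, with `Y` the reflection of `P`. In low
degrees `P` is Γ(Y) and `N` embeds in Γ(X), so the kernel of `P ⟶ N` is Γ(ker u) there, which is
finitely generated after truncation. -/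
theorem isCoherentModule_of_injective [IsCoherentSeq k E] {N : (algebraOf k E).GrMod}
    (hN : IsFG (algebraOf k E).isFreeFG N) {X : C} (φ : N ⟶ (sections k E).obj X) (n : ℤ)
    (hφ : ∀ i < n, Function.Injective (app φ i)) : (algebraOf k E).isCoherentModule N := by
  refine ⟨hN, fun P hP f => ?_⟩
  obtain ⟨Y, η, hη, n', hn'⟩ := exists_isReflection_of_isFreeFG k E hP
  obtain ⟨u, hu⟩ := hη.exists_desc (f ≫ φ)
  obtain ⟨r, hr⟩ := exists_sections_lift (kernel.ι f ≫ η) u (by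
    rw [Category.assoc, hu, kernel.condition_assoc, zero_comp])
  have hf (i : ℤ) (x : (kernel f).component i) : app f i (app (kernel.ι f) i x) = 0 :=
    congrArg (fun t => app t i x) (kernel.condition f)
  -- The truncation keeps degree `m` itself, whereas the bounds `n` and `n'` are strict.
  let m := min n n' - 1
  have hbij : ∀ i ≤ m, Function.Bijective (app r i) := by
    intro i hi
    have hin : i < n := by have := min_le_left n n'; lia
    have hin' : i < n' := by have := min_le_right n n'; lia
    have hr' (x) : app ((sections k E).map (kernel.ι u)) i (app r i x) =
        app η i (app (kernel.ι f) i x) := congrArg (fun t => app t i x) hr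
    constructor
    · intro x y hxy
      apply app_injective_of_mono (kernel.ι f) i
      apply (hn' i hin').1
      rw [← hr', ← hr', hxy]
    · intro y
      obtain ⟨z, hz⟩ := (hn' i hin').2 (app ((sections k E).map (kernel.ι u)) i y)
      have hfz : app f i z = 0 := by
        apply hφ i hin
        rw [← app_comp, ← hu, app_comp, hz, ← app_comp, ← Functor.map_comp, kernel.condition,
          Functor.map_zero, app_zero, map_zero]
      obtain ⟨x, rfl⟩ := exact_app _ _ _ (ShortComplex.exact_kernel f) i z hfz
      exact ⟨x, sections_map_injective_of_mono (kernel.ι u) i ((hr' x).trans hz)⟩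
  -- Above `m` both truncations vanish, so bijectivity of `r` up to degree `m` gives an isomorphism.
  have := isIso_of_app_bijective (((algebraOf k E).trunc m).map r) fun i =>
    trunc_map_bijective m r (hbij i)
  obtain ⟨R, hR, g, _⟩ := (isFG_trunc_sections k E (kernel u) m).of_epi
    (inv (((algebraOf k E).trunc m).map r))
  refine IsFG.of_genOn (n := m) (isLocallyFinite_of_mono (kernel.ι f)
    (isLocallyFinite_of_isFreeFG hP)) ⟨R, hR, g ≫ truncι m _, fun i hi => ?_⟩
  exact (truncι_bijective m _ (le_of_lt hi)).2.comp (app_surjective_of_epi g i)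

/-- The zero map, to the sections of an arbitrary object, is injective wherever `N` vanishes. -/
theorem isCoherentModule_of_bounded [IsCoherentSeq k E] {N : (algebraOf k E).GrMod}
    (hN : (algebraOf k E).isLocallyFinite N) (n : ℤ)
    (h : ∀ i < n, ∀ x : N.component i, x = 0) : (algebraOf k E).isCoherentModule N :=
  isCoherentModule_of_injective k E (isFG_of_bounded hN h) (X := E 0) 0 n
    fun i hi x y _ => (h i hi x).trans (h i hi y).symm

theorem isCoherent_algebraOf [IsCoherentSeq k E] : (algebraOf k E).IsCoherent := by
  refine ⟨fun j => ?_, fun j => ?_⟩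
  · have hP : (algebraOf k E).isFreeFG ((algebraOf k E).proj j) :=
      ⟨Unit, inferInstance, fun _ => j, ⟨(biproductUniqueIso fun _ : Unit => (algebraOf k E).proj j).symm⟩⟩
    obtain ⟨X, η, -, n, hn⟩ := exists_isReflection_of_isFreeFG k E hP
    exact isCoherentModule_of_injective k E ⟨_, hP, 𝟙 _, inferInstance⟩ η n
      fun i hi => (hn i hi).1
  · refine isCoherentModule_of_bounded k E ⟨fun i => ?_, j, fun i hi x => ?_⟩ j fun i hi x => ?_
    · exact inferInstanceAs (Module.Finite k (simpleComponent (k := k) j i))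
    · exact Subtype.ext (x.2 hi.ne')
    · exact Subtype.ext (x.2 hi.ne)

theorem isCoherentModule_trunc_sections [IsCoherentSeq k E] (m : ℤ) (X : C) :
    (algebraOf k E).isCoherentModule (truncObj m ((sections k E).obj X)) :=
  isCoherentModule_of_injective k E (isFG_trunc_sections k E X m) (truncι m _) 0
    fun i _ => truncι_injective m _ i

/-- The truncation is the kernel of `M ⟶ M / M_{≤ m}`, whose target is bounded and therefore
coherent. -/
theorem isCoherentModule_truncObj [IsCoherentSeq k E] (m : ℤ) {M : (algebraOf k E).GrMod}
    (hM : (algebraOf k E).isCoherentModule M) :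
    (algebraOf k E).isCoherentModule (truncObj m M) := by
  have hπ (i : ℤ) (x) : app (cokernel.π (truncι m M)) i (app (truncι m M) i x) = 0 :=
    congrArg (fun t => app t i x) (cokernel.condition (truncι m M))
  have hc : (algebraOf k E).isCoherentModule (cokernel (truncι m M)) := by
    refine isCoherentModule_of_bounded k E
      (isLocallyFinite_of_epi (cokernel.π _) (isLocallyFinite_of_isFG hM.1)) m fun i hi y => ?_
    obtain ⟨y, rfl⟩ := app_surjective_of_epi (cokernel.π (truncι m M)) i y
    obtain ⟨x, rfl⟩ := (truncι_bijective m M hi.le).2 y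
    exact hπ i x
  exact (hM.kernel hc (cokernel.π (truncι m M))).of_iso
    ((kernelIsKernel _).conePointUniqueUpToIso (Abelian.monoIsKernelOfCokernel _
      (cokernelIsCokernel (truncι m M))))

/-- A reflection behaves like a left adjoint, so it turns a presentation `R ⟶ P ⟶ M ⟶ 0` into a
cokernel in `C`. Coherence of `M` is what provides `R`. -/
theorem exists_reflection_of_isCoherentModule [IsProjectiveSeq E] {M : (algebraOf k E).GrMod}
    (hM : (algebraOf k E).isCoherentModule M) :
    ∃ (X : C) (η : M ⟶ (sections k E).obj X), IsReflection k E η ∧ IsLowBijective η := by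
  obtain ⟨⟨P, hP, p, _⟩, hK⟩ := hM
  obtain ⟨R, hR, q, _⟩ := hK P hP p
  obtain ⟨X₀, η₀, h₀, n₀, hn₀⟩ := exists_isReflection_of_isFreeFG k E hP
  obtain ⟨X₁, η₁, h₁, n₁, hn₁⟩ := exists_isReflection_of_isFreeFG k E hR
  obtain ⟨d, hd⟩ := h₁.exists_desc (q ≫ kernel.ι p ≫ η₀)
  have hd' (i : ℤ) (x) : app ((sections k E).map d) i (app η₁ i x) =
      app η₀ i (app (kernel.ι p) i (app q i x)) := congrArg (fun t => app t i x) hd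
  have w : kernel.ι p ≫ η₀ ≫ (sections k E).map (cokernel.π d) = 0 := by
    rw [← cancel_epi q, comp_zero]
    have := congrArg (fun t => t ≫ (sections k E).map (cokernel.π d)) hd
    simp only [Category.assoc, ← Functor.map_comp, cokernel.condition, Functor.map_zero,
      comp_zero] at this
    exact this.symm
  -- The epimorphism `p` is the cokernel of its kernel, and `w` says that this kernel dies in
  -- Γ(coker d).
  let hp := Abelian.epiIsCokernelOfKernel _ (kernelIsKernel p)
  let η : M ⟶ (sections k E).obj (cokernel d) := hp.desc (CokernelCofork.ofπ _ w)
  have hη : p ≫ η = η₀ ≫ (sections k E).map (cokernel.π d) :=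
    hp.fac (CokernelCofork.ofπ _ w) WalkingParallelPair.one
  have hη' (i : ℤ) (x) : app η i (app p i x) =
      app ((sections k E).map (cokernel.π d)) i (app η₀ i x) := congrArg (fun t => app t i x) hη
  refine ⟨cokernel d, η, ⟨fun Y h => ?_, fun Y u hu => ?_⟩, ?_⟩
  · obtain ⟨u, hu⟩ := h₀.exists_desc (p ≫ h)
    have hdu : d ≫ u = 0 := by
      apply h₁.eq_zero
      rw [Functor.map_comp, reassoc_of% hd, hu, kernel.condition_assoc, zero_comp, comp_zero]
    refine ⟨cokernel.desc d u hdu, ?_⟩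
    rw [← cancel_epi p, reassoc_of% hη, ← Functor.map_comp, cokernel.π_desc, hu]
  · rw [← cancel_epi (cokernel.π d), comp_zero]
    apply h₀.eq_zero
    rw [Functor.map_comp, ← reassoc_of% hη, hu, comp_zero]
  -- A five-lemma chase: in low degrees Γ(X₁) ⟶ Γ(X₀) ⟶ Γ(coker d) ⟶ 0 is exact, and its first two
  -- terms agree with `R` and `P`.
  · obtain ⟨n₂, hn₂⟩ := exists_sections_map_surjective k E (cokernel.π d)
    obtain ⟨n₃, hn₃⟩ := exists_sections_exact k E d (cokernel.π d) (cokernel.condition d)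
      (ShortComplex.exact_cokernel d)
    refine ⟨min (min n₀ n₁) (min n₂ n₃), fun i hi => ?_⟩
    simp only [lt_min_iff] at hi
    obtain ⟨⟨hi₀, hi₁⟩, hi₂, hi₃⟩ := hi
    refine ⟨(injective_iff_map_eq_zero (app η i)).2 fun y hy => ?_, fun z => ?_⟩
    · obtain ⟨x, rfl⟩ := app_surjective_of_epi p i y
      rw [hη'] at hy
      obtain ⟨t, ht⟩ := hn₃ i hi₃ _ hy
      obtain ⟨s, rfl⟩ := (hn₁ i hi₁).2 t
      rw [hd'] at ht
      rw [← (hn₀ i hi₀).1 ht, ← app_comp, kernel.condition, app_zero]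
    · obtain ⟨t, rfl⟩ := hn₂ i hi₂ z
      obtain ⟨x, rfl⟩ := (hn₀ i hi₀).2 t
      exact ⟨app p i x, hη' i x⟩

/-! ### The comparison functor -/

variable [IsCoherentSeq k E]

/-- The functor `X ↦ ⨁_{i ≤ 0} Hom (E i, X)` with values in coherent modules. -/
def cohSections : C ⥤ (algebraOf k E).Coh :=
  ObjectProperty.lift _ (sections k E ⋙ (algebraOf k E).trunc 0)
    (isCoherentModule_trunc_sections k E 0)

theorem cohSections_isLowBijective {X Y : C} {f : X ⟶ Y}
    (hf : IsLowBijective ((sections k E).map f)) :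
    IsLowBijective ((cohSections k E).map f).hom := by
  obtain ⟨n, hn⟩ := hf
  exact ⟨n, fun i hi => trunc_map_bijective 0 _ fun _ => hn i hi⟩

instance : (cohSections k E).Additive where
  map_add {X Y f g} := by
    apply ObjectProperty.hom_ext
    exact congrArg ((algebraOf k E).trunc 0).map ((sections k E).map_add (f := f) (g := g))

instance : (cohSections k E).Linear k where
  map_smul f r := by
    apply ObjectProperty.hom_ext
    exact congrArg ((algebraOf k E).trunc 0).map (sections_map_smul k E r f)

/-- The functor from `C` to `cohproj A(E)`. -/
def toCohProj : C ⥤ CohProj (algebraOf k E) :=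
  cohSections k E ⋙ (algebraOf k E).cohBounded.isoModSerre.Q

instance : (toCohProj k E).Additive :=
  inferInstanceAs (cohSections k E ⋙ (algebraOf k E).cohBounded.isoModSerre.Q).Additive

instance : (toCohProj k E).Linear k :=
  inferInstanceAs (Functor.Linear k (cohSections k E ⋙ (algebraOf k E).cohBounded.isoModSerre.Q))

variable {k E} in
/-- The truncation of a coherent module, as a coherent module. -/
def cohTrunc (M : (algebraOf k E).Coh) : (algebraOf k E).Coh :=
  ⟨truncObj 0 M.obj, isCoherentModule_truncObj k E 0 M.property⟩

variable {k E} in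
/-- The inclusion of the truncation of a coherent module. -/
def cohTruncι (M : (algebraOf k E).Coh) : cohTrunc M ⟶ M := ObjectProperty.homMk (truncι 0 M.obj)

variable {k E} in
theorem cohTruncι_isLowBijective (M : (algebraOf k E).Coh) :
    IsLowBijective (cohTruncι M).hom := ⟨0, fun _ hi => truncι_bijective 0 M.obj hi.le⟩

variable {k E} in
/-- The morphism from the truncation of a coherent module induced by a morphism to a module of
sections. -/
def cohTruncMap {M : (algebraOf k E).Coh} {X : C} (η : M.obj ⟶ (sections k E).obj X) :
    cohTrunc M ⟶ (cohSections k E).obj X := ObjectProperty.homMk (((algebraOf k E).trunc 0).map η)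

variable {k E} in
theorem cohTruncMap_isLowBijective {M : (algebraOf k E).Coh} {X : C}
    {η : M.obj ⟶ (sections k E).obj X} (hη : IsLowBijective η) :
    IsLowBijective (cohTruncMap η).hom := by
  obtain ⟨n, hn⟩ := hη
  exact ⟨n, fun i hi => trunc_map_bijective 0 _ fun _ => hn i hi⟩

variable {k E} in
theorem cohTruncMap_comp {M : (algebraOf k E).Coh} {X Y : C}
    (η : M.obj ⟶ (sections k E).obj X) (u : X ⟶ Y) (f : M ⟶ (cohSections k E).obj Y)
    (h : η ≫ (sections k E).map u = f.hom ≫ truncι 0 _) :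
    cohTruncMap η ≫ (cohSections k E).map u = cohTruncι M ≫ f := by
  apply ObjectProperty.hom_ext
  exact (cancel_mono (truncι 0 ((sections k E).obj Y))).1
    (congrArg (fun t => truncι 0 M.obj ≫ t) h)

/-! ### Essential surjectivity, and morphisms as fractions -/

instance : (toCohProj k E).EssSurj where
  mem_essImage Z := by
    have := Localization.essSurj (algebraOf k E).cohBounded.isoModSerre.Q
      (algebraOf k E).cohBounded.isoModSerre
    let Q := (algebraOf k E).cohBounded.isoModSerre.Q
    let M : (algebraOf k E).Coh := Q.objPreimage Z
    obtain ⟨X, η, -, hη⟩ := exists_reflection_of_isCoherentModule k E M.property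
    -- In the quotient both arrows of `M` ⟵ `M_{≤ 0}` ⟶ Γ(X)_{≤ 0} become invertible.
    have h₁ := isIso_Q_map _ (cohTruncMap_isLowBijective hη)
    have h₂ := isIso_Q_map _ (cohTruncι_isLowBijective M)
    exact ⟨X, ⟨(asIso (Q.map (cohTruncMap η))).symm ≪≫ asIso (Q.map (cohTruncι M)) ≪≫
      Q.objObjPreimageIso Z⟩⟩

/-- Every morphism between objects in the image of `toCohProj` is a fraction. -/
theorem exists_comp_toCohProj_map_eq {X Y : C}
    (φ : (toCohProj k E).obj X ⟶ (toCohProj k E).obj Y) :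
    ∃ (Z : C) (s : Z ⟶ X) (f : Z ⟶ Y), IsLowBijective ((sections k E).map s) ∧
      (toCohProj k E).map s ≫ φ = (toCohProj k E).map f := by
  let W := (algebraOf k E).cohBounded.isoModSerre
  obtain ⟨z, hz⟩ := Localization.exists_rightFraction W.Q W φ
  -- The vertex of the fraction is replaced by its reflection `Z`; by universality both legs come
  -- from morphisms out of `Z` in `C`.
  obtain ⟨Z, η, hη, n, hn⟩ := exists_reflection_of_isCoherentModule k E z.X'.property
  obtain ⟨s, hs⟩ := hη.exists_desc (z.s.hom ≫ truncι 0 _)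
  obtain ⟨f, hf⟩ := hη.exists_desc (z.f.hom ≫ truncι 0 _)
  have hs' := cohTruncMap_comp η s z.s hs
  have hf' := cohTruncMap_comp η f z.f hf
  obtain ⟨n', hn'⟩ := (isoModSerre_iff_isLowBijective z.s).1 z.hs
  refine ⟨Z, s, f, ⟨min (min n n') 0, fun i hi => ?_⟩, ?_⟩
  · simp only [lt_min_iff] at hi
    -- Two out of three: `η`, the denominator `z.s` and, below degree 0, the inclusion of the
    -- truncation are bijective in low degrees.
    have h : Function.Bijective (app ((sections k E).map s) i ∘ app η i) := by
      have : app ((sections k E).map s) i ∘ app η i = app (truncι 0 _) i ∘ app z.s.hom i :=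
        funext fun x => congrArg (fun t => app t i x) hs
      rw [this]
      exact (truncι_bijective 0 _ hi.2.le).comp (hn' i hi.1.2)
    exact (Function.Bijective.of_comp_iff _ (hn i hi.1.1)).1 h
  -- Precomposing with this isomorphism reduces the identity to the defining relation of the
  -- fraction `z`.
  · have := isIso_Q_map (cohTruncMap η) (cohTruncMap_isLowBijective ⟨n, hn⟩)
    subst hz
    change W.Q.map ((cohSections k E).map s) ≫ z.map W.Q _ = W.Q.map ((cohSections k E).map f)
    rw [← cancel_epi (W.Q.map (cohTruncMap η)), ← W.Q.map_comp_assoc, hs', W.Q.map_comp,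
      Category.assoc, MorphismProperty.RightFraction.map_s_comp_map, ← W.Q.map_comp,
      ← W.Q.map_comp, hf']

/-! ### The equivalence between `C/C₀` and `cohproj A` -/

set_option linter.overlappingInstances false

variable [IsProjectiveSeq E]

theorem isInvertedBy_toCohProj : (nullObjects E).isoModSerre.IsInvertedBy (toCohProj k E) :=
  fun _ _ f hf => isIso_Q_map _
    (cohSections_isLowBijective k E ((isoModSerre_nullObjects_iff k E f).1 hf))

/-- A morphism dies in a Serre quotient when its image lies in the subcategory, so Γ(f) vanishes in
low degrees. By projectivity, low-degree sections of the image of `f` lift to `X`, hence are zero in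
Γ(Y). -/
theorem nullObjects_image_of_toCohProj_map_eq_zero {X Y : C} (f : X ⟶ Y)
    (hf : (toCohProj k E).map f = 0) : nullObjects E (Abelian.image f) := by
  have h : (algebraOf k E).cohBounded (Abelian.image ((cohSections k E).map f)) :=
    (ObjectProperty.SerreClassLocalization.map_eq_zero_iff
      (algebraOf k E).cohBounded.isoModSerre.Q (algebraOf k E).cohBounded _).1 hf
  obtain ⟨n, hn⟩ := (cohBounded_iff _).1 h
  have hz : ∀ i < n, ∀ x, app ((cohSections k E).map f).hom i x = 0 := by
    intro i hi x
    rw [← Abelian.image.fac ((cohSections k E).map f)]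
    refine (congrArg (app (Abelian.image.ι ((cohSections k E).map f)).hom i)
      (hn i hi (app (Abelian.factorThruImage ((cohSections k E).map f)).hom i x))).trans
      (map_zero _)
  obtain ⟨n', hn'⟩ := exists_sections_map_surjective k E (Abelian.factorThruImage f)
  refine (nullObjects_iff k E _).2 ⟨min (min n n') 0, fun i hi y => ?_⟩
  simp only [lt_min_iff] at hi
  obtain ⟨x, rfl⟩ := hn' i hi.1.2 y
  obtain ⟨x, rfl⟩ := (truncι_bijective 0 _ hi.2.le).2 x
  apply sections_map_injective_of_mono (Abelian.image.ι f) i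
  rw [← app_comp, ← Functor.map_comp, Abelian.image.fac, map_zero]
  exact congrArg (app (truncι 0 _) i) (hz i hi.1.1 x)

/-- The functor induced by `toCohProj` on the quotient by the null objects. -/
def quotientToCohProj : SerreQuotient (nullObjects E) ⥤ CohProj (algebraOf k E) :=
  Localization.lift (toCohProj k E) (isInvertedBy_toCohProj k E) (nullObjects E).isoModSerre.Q

/-- The factorization of `toCohProj`. -/
def quotientToCohProjFac :
    (nullObjects E).isoModSerre.Q ⋙ quotientToCohProj k E ≅ toCohProj k E :=
  Localization.fac _ _ _

instance : Localization.Lifting (nullObjects E).isoModSerre.Q (nullObjects E).isoModSerre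
    (toCohProj k E) (quotientToCohProj k E) := ⟨quotientToCohProjFac k E⟩

instance : (quotientToCohProj k E).Additive := by
  rw [Localization.functor_additive_iff (nullObjects E).isoModSerre.Q
    (nullObjects E).isoModSerre]
  exact Functor.additive_of_iso (quotientToCohProjFac k E).symm

instance : (quotientToCohProj k E).Linear k :=
  (Localization.functor_linear_iff (nullObjects E).isoModSerre.Q (nullObjects E).isoModSerre k
    (toCohProj k E) (quotientToCohProj k E)).1 inferInstance

instance : (quotientToCohProj k E).Faithful := by
  -- The calculus of fractions reduces faithfulness to morphisms coming from `C`.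
  refine Functor.faithful_of_comp_cancel_zero_of_hasLeftCalculusOfFractions
    (nullObjects E).isoModSerre.Q (nullObjects E).isoModSerre _ fun X Y f hf => ?_
  rw [ObjectProperty.SerreClassLocalization.map_eq_zero_iff _ (nullObjects E)]
  apply nullObjects_image_of_toCohProj_map_eq_zero k E
  have h := (quotientToCohProjFac k E).inv.naturality f
  rwa [Functor.comp_map, hf, comp_zero, ← zero_comp (X := (toCohProj k E).obj X)
    (f := (quotientToCohProjFac k E).inv.app Y), cancel_mono] at h

instance : (quotientToCohProj k E).Full := by
  let W := (nullObjects E).isoModSerre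
  let G := quotientToCohProj k E
  let e := quotientToCohProjFac k E
  have := Localization.essSurj W.Q W
  have key : ∀ (X Y : C) (φ : G.obj (W.Q.obj X) ⟶ G.obj (W.Q.obj Y)),
      ∃ ψ, G.map ψ = φ := by
    intro X Y φ
    obtain ⟨Z, s, f, hs, h⟩ := exists_comp_toCohProj_map_eq k E (e.inv.app X ≫ φ ≫ e.hom.app Y)
    have : IsIso (W.Q.map s) :=
      Localization.inverts W.Q W s ((isoModSerre_nullObjects_iff k E s).2 hs)
    -- The denominator `s` is bijective on low-degree sections, hence invertible modulo C₀, so the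
    -- fraction already makes sense in `C/C₀`.
    refine ⟨inv (W.Q.map s) ≫ W.Q.map f, ?_⟩
    have hsn : G.map (W.Q.map s) ≫ e.hom.app X = e.hom.app Z ≫ (toCohProj k E).map s :=
      e.hom.naturality s
    have hfn : G.map (W.Q.map f) ≫ e.hom.app Y = e.hom.app Z ≫ (toCohProj k E).map f :=
      e.hom.naturality f
    rw [← cancel_epi (G.map (W.Q.map s)), ← G.map_comp, IsIso.hom_inv_id_assoc,
      ← cancel_mono (e.hom.app Y), hfn, ← h, ← reassoc_of% hsn, Iso.hom_inv_id_app_assoc,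
      Category.assoc]
  constructor
  intro X Y φ
  let a := W.Q.objObjPreimageIso X
  let b := W.Q.objObjPreimageIso Y
  obtain ⟨ψ, hψ⟩ := key _ _ (G.map a.hom ≫ φ ≫ G.map b.inv)
  refine ⟨a.inv ≫ ψ ≫ b.hom, ?_⟩
  change G.map _ = φ
  rw [G.map_comp, G.map_comp, hψ]
  simp only [Category.assoc, ← G.map_comp, b.inv_hom_id, G.map_id]
  rw [← G.map_comp_assoc, a.inv_hom_id, G.map_id, Category.id_comp]
  exact Category.comp_id φ

instance : (quotientToCohProj k E).EssSurj where
  mem_essImage Z := ⟨_, ⟨(quotientToCohProjFac k E).app _ ≪≫ (toCohProj k E).objObjPreimageIso Z⟩⟩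

instance : (quotientToCohProj k E).IsEquivalence where

end NCProj

theorem mainTheorem1 {k : Type v} [Field k] {C : Type u} [Category.{v} C] [Abelian C]
    [Linear k C] (E : ℤ → C) [NCProj.IsHomFinite k E] [NCProj.IsCoherentSeq k E] :
    haveI : NCProj.IsProjectiveSeq E := NCProj.IsCoherentSeq.toIsProjectiveSeq k
    (NCProj.algebraOf k E).IsCoherent ∧
    (∃ e : NCProj.SerreQuotient (NCProj.nullObjects E) ≌ NCProj.CohProj (NCProj.algebraOf k E),
      e.functor.Additive ∧ e.functor.Linear k) ∧
    (NCProj.IsAmpleSeq k E →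
      ∃ e : C ≌ NCProj.CohProj (NCProj.algebraOf k E),
        e.functor.Additive ∧ e.functor.Linear k) := by
  have : NCProj.IsProjectiveSeq E := NCProj.IsCoherentSeq.toIsProjectiveSeq k
  refine ⟨NCProj.isCoherent_algebraOf k E, ⟨(NCProj.quotientToCohProj k E).asEquivalence,
    inferInstanceAs (NCProj.quotientToCohProj k E).Additive,
    inferInstanceAs ((NCProj.quotientToCohProj k E).Linear k)⟩, fun h => ?_⟩
  -- In the ample case C₀ consists of zero objects, so passing to the quotient changes nothing.
  obtain ⟨e, _, _⟩ := NCProj.exists_equivalence_of_isZero k (NCProj.nullObjects E)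
    h.isZero_of_null
  exact ⟨e.trans (NCProj.quotientToCohProj k E).asEquivalence,
    inferInstanceAs (e.functor ⋙ NCProj.quotientToCohProj k E).Additive,
    inferInstanceAs ((e.functor ⋙ NCProj.quotientToCohProj k E).Linear k)⟩
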